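/- **Notation.** $\{1\}^d$ denotes $d$ repetitions of $1$. For finite tuples $\mathbf s_i=(s_{i,1},\dots,s_{i,n_i})$ ($1\le i\le r$) and $\mathbf w=(w_1,\dots,w_{p+1})$ of complex numbers, the generalized Mordell–Tornheim multiple zeta function (GMT-type MZF) is $$\zeta_{MT}(\mathbf s_1,\dots,\mathbf s_r;\mathbf w)=\sum_{\substack{m_{i,j}\ge1\ (1\le i\le r,\,1\le j\le n_i)\\ m'_1,\dots,m'_p\ge1}}\frac{1}{\prod_{i=1}^r\prod_{h=1}^{n_i}\bigl(\sum_{j\le h}m_{i,j}\bigr)^{s_{i,h}}\ \prod_{u=1}^{p+1}\bigl(\sum_{i=1}^{r}\sum_{j=1}^{n_i}m_{i,j}+\sum_{v<u}m'_v\bigr)^{w_u}},$$ where an empty tuple $\mathbf s_i$ ($n_i=0$) is simply omitted, and the parentheses around a tuple of length one are dropped. The Euler–Zagier multiple zeta function is $\zeta(s_1,\dots,s_d)=\sum_{0<m_1<\dots<m_d}m_1^{-s_1}\cdots m_d^{-s_d}$. For $\mathbf h=(h_1,\dots,h_r)\in\mathbb Z_{\ge1}^r$ and $q\in\mathbb Z_{\ge0}$,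 the generalized Ito zeta function is $$\xi_{MT}((\mathbf h;q);s)=\frac1{\Gamma(s)}\int_0^\infty\frac{t^{s-1}}{e^t-1}\,\mathrm{Li}_{\mathbf h;q}(1-e^{-t})\,dt\quad(\Re s>1-r),\qquad \mathrm{Li}_{\mathbf h;q}(z)=\sum_{m_1,\dots,m_r\ge1}\frac{z^{m_1+\dots+m_r}}{m_1^{h_1}\cdots m_r^{h_r}(m_1+\dots+m_r)^q}.$$ For integers $k\ge2$ and $0\le j\le 2k-2$ put $$a(j,k)=\begin{cases}(-1)^j\zeta(k-j)&(j<k-1)\\(-1)^{k-1}&(j\ge k-1)\end{cases},\qquad \mathbf k(j,k)=\begin{cases}(\{1\}^j)&(j\le k-1)\\(\{1\}^{j-k},2,\{1\}^{2k-2-j})&(j>k-1)\end{cases},$$ and for $\mathbf k=(k_1,\dots,k_n)$, $\mathbf j=(j_1,\dots,j_n)$ put $a_n(\mathbf j,\mathbf k)=\prod_{i=1}^n a(j_i,k_i)$ and $b_n(\mathbf j,\mathbf k)=|\{i: j_i=k_i-1\}|$. **Theorem.** Let $n\ge1$, $l\ge0$, $\mathbf k=(k_1,\dots,k_n)\in\mathbb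 Z_{\ge2}^n$ and $k_{n+1}\in\mathbb Z_{\ge0}$. The integral defining $\xi_{MT}((\{1\}^l,\mathbf k;k_{n+1});s)$ converges absolutely for $\Re s>1-(l+n)$, the series below that depend on $s$ converge absolutely for $\Re s>1$, and the values $\zeta_{MT}(\{1\}^l,\mathbf k;i)$ below are given by absolutely convergent series. All these functions of $s$ have meromorphic continuations to $\mathbb C$, holomorphic on the half-planes just named, and the continued functions satisfy $$\begin{aligned} &(-1)^{k_{n+1}}\,\xi_{MT}((\{1\}^l,\mathbf k;k_{n+1});s)\\ &=\sum_{\substack{0\le j_1\le 2k_1-2\\ \vdots\\ 0\le j_n\le 2k_n-2}}\ \sum_{c_1+\dots+c_{k_{n+1}+1}=l+b_n(\mathbf j,\mathbf k)}\bigl(l+b_n(\mathbf j,\mathbf k)\bigr)!\;a_n(\mathbf j,\mathbf k)\binom{s+c_{k_{n+1}+1}-1}{c_{k_{n+1}+1}}\\ &\qquad\times\zeta_{MT}\bigl(0,\mathbf k(j_1,k_1),\dots,\mathbf k(j_n,k_n);\,c_1+1,\dots,c_{k_{n+1}}+1,\,c_{k_{n+1}+1}+s\bigr)\\ &\quad-\sum_{i=1}^{k_{n+1}}(-1)^{i-1}\,\zeta_{MT}(\{1\}^l,\mathbf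 k;i)\,\zeta(\{1\}^{k_{n+1}-i},s) \end{aligned}$$ for all $s\in\mathbb C$, where the $c_u$ run over non-negative integers. The identity is one of meromorphic functions on $\mathbb C$; at every $s$ at which none of the functions $\zeta_{MT}(\dots)$, $\zeta(\{1\}^{k_{n+1}-i},s)$ on the right-hand side has a pole, the left-hand side is holomorphic and the identity holds between the values. -/

import Mathlib

open Filter Topology

/-- The multi-polylogarithm of Mordell-Tornheim type,
`Li_{k;q}(z) = ∑_{m_1, …, m_r ≥ 1} z^(m_1 + ⋯ + m_r) / (m_1^{k_1} ⋯ m_r^{k_r} (m_1 + ⋯ + m_r)^q)`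
(for `|z| < 1`). -/
noncomputable def multiLi {r : ℕ} (k : Fin r → ℕ) (q : ℕ) (z : ℂ) : ℂ :=
  ∑' m : Fin r → ℕ+,
    z ^ (∑ i, (m i : ℕ)) /
      ((∏ i, ((m i : ℕ) : ℂ) ^ k i) * ((∑ i, (m i : ℕ) : ℕ) : ℂ) ^ q)

/-- The integrand `t^(s-1) / (e^t - 1) * Li_{k;q}(1 - e^{-t})` of the generalized Ito zeta
function. -/
noncomputable def itoIntegrand {r : ℕ} (k : Fin r → ℕ) (q : ℕ) (s : ℂ) (t : ℝ) : ℂ :=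
  (t : ℂ) ^ (s - 1) / (Complex.exp (t : ℂ) - 1) * multiLi k q (1 - Complex.exp (-(t : ℂ)))

/-- The generalized Ito zeta function
`ξ((k;q);s) = Γ(s)⁻¹ ∫_0^∞ t^(s-1) / (e^t - 1) * Li_{k;q}(1 - e^{-t}) dt`,
as an integral (convergent for `Re s > 1 - r`). At `s = 0, -1, -2, …` Mathlib has `Γ(s) = 0`, so
that the factor `1 / Γ(s)` takes its correct value `0` there. -/
noncomputable def itoZeta {r : ℕ} (k : Fin r → ℕ) (q : ℕ) (s : ℂ) : ℂ :=
  1 / Complex.Gamma s * ∫ t in Set.Ioi (0 : ℝ), itoIntegrand k q s t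

/-- The term of the Euler-Zagier series `ζ(s_1, …, s_d)` at `0 < m_1 < ⋯ < m_d`. -/
noncomputable def ezTerm {d : ℕ} (s : Fin d → ℂ) (m : {m : Fin d → ℕ+ // StrictMono m}) : ℂ :=
  1 / ∏ i, ((m.1 i : ℕ) : ℂ) ^ s i

/-- The Euler-Zagier multiple zeta function, as a series over `0 < m_1 < ⋯ < m_d`. -/
noncomputable def ezZeta {d : ℕ} (s : Fin d → ℂ) : ℂ :=
  ∑' m : {m : Fin d → ℕ+ // StrictMono m}, ezTerm s m

/-- The term of the generalized Mordell-Tornheim series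
`ζ_MT(𝐬_1, …, 𝐬_r; w)`, where `𝐬_i = s i` is a finite tuple and `w = (w_1, …, w_{p+1})`:
`1 / (∏_i ∏_k (∑_{j ≤ k} m_{i,j})^{s_{i,k}} ∏_u (∑_i ∑_j m_{i,j} + ∑_{v < u} m'_v)^{w_u})`.
A block `𝐬_i` that is the empty tuple contributes nothing, that is, it is left out. -/
noncomputable def gmtTerm {r p : ℕ} (s : Fin r → List ℂ) (w : Fin (p + 1) → ℂ)
    (m : ((i : Fin r) → Fin (s i).length → ℕ+) × (Fin p → ℕ+)) : ℂ :=
  1 / ((∏ i : Fin r, ∏ k : Fin (s i).length,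
          ((∑ j ∈ Finset.univ.filter (fun j => j ≤ k), (m.1 i j : ℕ) : ℕ) : ℂ) ^ (s i).get k) *
        ∏ u : Fin (p + 1),
          (((∑ i : Fin r, ∑ j : Fin (s i).length, (m.1 i j : ℕ)) +
            ∑ v ∈ Finset.univ.filter (fun v : Fin p => v.castSucc < u), (m.2 v : ℕ) : ℕ) : ℂ)
              ^ w u)

/-- The generalized Mordell-Tornheim multiple zeta function, as a series over positive integers. -/
noncomputable def gmtZeta {r p : ℕ} (s : Fin r → List ℂ) (w : Fin (p + 1) → ℂ) : ℂ :=
  ∑' m : ((i : Fin r) → Fin (s i).length → ℕ+) × (Fin p → ℕ+), gmtTerm s w m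

/-- The tuple `𝐤(j,k)`: `{1}^j` if `j ≤ k - 1`, and `({1}^{j-k}, 2, {1}^{2k-2-j})` if
`j > k - 1`. -/
def kTuple (j k : ℕ) : List ℂ :=
  if j < k then List.replicate j 1
  else List.replicate (j - k) 1 ++ 2 :: List.replicate (2 * k - 2 - j) 1

/-- `a(j,k) = (-1)^j ζ(k-j)` if `j < k - 1`, and `(-1)^(k-1)` if `j ≥ k - 1`. -/
noncomputable def aCoeff (j k : ℕ) : ℂ :=
  if j < k - 1 then (-1) ^ j * riemannZeta ((k - j : ℕ) : ℂ) else (-1) ^ (k - 1)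

/-- `b_n(𝐣,𝐤) = |{i : j_i = k_i - 1}|`. -/
def bCount {n : ℕ} (j k : Fin n → ℕ) : ℕ :=
  (Finset.univ.filter (fun i => j i = k i - 1)).card

/-- The index `({1}^l, k_1, …, k_n)`. -/
def onesAppend {n : ℕ} (l : ℕ) (k : Fin n → ℕ) : Fin (l + n) → ℕ :=
  Fin.append (fun _ => 1) k

/-- The blocks `({1}^l, k_1, …, k_n)`, each of length one, of `ζ_MT({1}^l, 𝐤; ·)`. -/
def onesBlocks {n : ℕ} (l : ℕ) (k : Fin n → ℕ) : Fin (l + n) → List ℂ :=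
  fun i => [(onesAppend l k i : ℂ)]

/-- The blocks `0, 𝐤(j_1,k_1), …, 𝐤(j_n,k_n)`. -/
def zeroBlocks {n : ℕ} (j k : Fin n → ℕ) : Fin (n + 1) → List ℂ :=
  Fin.cons [0] (fun i => kTuple (j i) (k i))

/-- The last argument `(c_1 + 1, …, c_q + 1, c_{q+1} + s)`. -/
def cIndex {q : ℕ} (c : Fin (q + 1) → ℕ) (s : ℂ) : Fin (q + 1) → ℂ :=
  Fin.snoc (fun u : Fin q => (c u.castSucc : ℂ) + 1) ((c (Fin.last q) : ℂ) + s)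

/-- The index `({1}^d, s)`. -/
def onesSnoc (d : ℕ) (s : ℂ) : Fin (d + 1) → ℂ :=
  Fin.snoc (fun _ : Fin d => (1 : ℂ)) s

/-- `F` is the meromorphic continuation to `ℂ` of the function `f` given on the half plane
`Re s > σ`: it is meromorphic on `ℂ`, holomorphic on the half plane and equal to `f` there.
The normal form says that `F` has no removable singularities and takes the value `0` at its poles,
so that `F` is unique. -/
structure IsMeromorphicContinuation (f : ℂ → ℂ) (σ : ℝ) (F : ℂ → ℂ) : Prop where
  meromorphic : MeromorphicNFOn F Set.univ
  analyticAt : ∀ s : ℂ, σ < s.re → AnalyticAt ℂ F s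
  eq : ∀ s : ℂ, σ < s.re → F s = f s

/-- The right-hand side of the functional relation at `s`, where `Z 𝐣 c` stands for the function
`s ↦ ζ_MT(0, 𝐤(j_1,k_1), …, 𝐤(j_n,k_n); c_1 + 1, …, c_q + 1, c_{q+1} + s)` and `E d` for the
function `s ↦ ζ({1}^d, s)`. -/
noncomputable def relationRHS {n : ℕ} (l : ℕ) (k : Fin n → ℕ) (q : ℕ)
    (Z : (Fin n → ℕ) → (Fin (q + 1) → ℕ) → ℂ → ℂ) (E : ℕ → ℂ → ℂ) (s : ℂ) : ℂ :=
  (∑ j ∈ Fintype.piFinset (fun i => Finset.Icc 0 (2 * k i - 2)),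
    ∑ c ∈ Finset.Nat.antidiagonalTuple (q + 1) (l + bCount j k),
      (Nat.factorial (l + bCount j k) : ℂ) * (∏ i, aCoeff (j i) (k i)) *
        Ring.choose (s + c (Fin.last q) - 1) (c (Fin.last q)) * Z j c s) -
  ∑ i ∈ Finset.Icc 1 q,
    (-1) ^ (i - 1) * gmtZeta (onesBlocks l k) (fun _ : Fin 1 => (i : ℂ)) * E (q - i) s

/-! Put z = 1 - e^(-t), so that dz/z = dt/(e^t - 1). Hence the t-derivative of Li_{h;q+1}(z) is
Li_{h;q}(z)/(e^t - 1), and Li_{h;q+1}(z) is its value at z = 1 minus the integral from t to infinity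
of Li_{h;q}/(e^u - 1) (`mtPolylog_succ`). Iterating (`mtPolylog_eq`) gives (-1)^q times the q-th
iterate of the operator `boseTail` on Li_{h;0}, plus constants times iterates on 1. The latter are
Li_{1,...,1}(e^(-t)) and produce the subtracted sum of the theorem.

For q = 0 the multi-polylogarithm is a product of one-variable ones. The l indices equal to 1 give t
each. For r = 1 the same recursion, started from Li_1(z) = t, writes Li_k(z) as the sum over j of
a(j,k) Li_{k(j,k)}(e^(-t)), with an extra factor t at j = k - 1 (`polylog_eq_sum`). Multiplying out
gives t^(l+b) times products of polylogarithms at e^(-t). Pushing `boseTail` q times past such a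
power by parts distributes l + b over q + 1 slots: that is the sum over c
(`boseTail_iterate_dividedPower_mul`).

Everything is now a series of exponentials e^(-pt) with nonnegative coefficients: multiplication by
1/(e^t - 1) adds a summation variable, and a tail integral divides the term by p (`IsExpSeries`).
The Mellin transform turns such a series into Γ(s) times a Dirichlet series, here a Mordell-Tornheim
or Euler-Zagier series. The leftover factor t^c/c! shifts s to s + c, and Γ(s+c)/c! is the binomial
coefficient times Γ(s). This proves the relation for Re s > 1 (`neg_one_pow_mul_itoZeta`).

For the continuation, all functions involved have expansions at 0 in t^i (log t)^j, a class stable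
under sums, products and tail integrals (`IsTame`). Subtracting a long enough expansion on (0,1]
continues the Mellin transform to any half-plane, and these continuations glue
(`IsTame.exists_meromorphic_mellin`). The identity theorem extends the relation to the plane, and
meromorphic normal forms settle the values at individual points. -/

open Set MeasureTheory Asymptotics

/-! ### Asymptotic expansions at 0 in powers and logarithms. -/

/-- The function `t ↦ t ^ i * (log t) ^ j` on the positive half-line, extended by zero. -/
noncomputable def logMonomial (p : ℤ × ℕ) (t : ℝ) : ℝ :=
  if 0 < t then t ^ p.1 * Real.log t ^ p.2 else 0

/-- The span of the functions `t ^ i * (log t) ^ j` on the positive half-line. -/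
noncomputable def logPoly : Submodule ℝ (ℝ → ℝ) := Submodule.span ℝ (range logMonomial)

theorem logMonomial_of_pos (p : ℤ × ℕ) {t : ℝ} (ht : 0 < t) :
    logMonomial p t = t ^ p.1 * Real.log t ^ p.2 := if_pos ht

theorem logMonomial_mul (p q : ℤ × ℕ) :
    logMonomial p * logMonomial q = logMonomial (p.1 + q.1, p.2 + q.2) := by
  funext t
  by_cases ht : 0 < t
  · simp only [Pi.mul_apply, logMonomial_of_pos _ ht, zpow_add₀ ht.ne', pow_add]
    ring
  · simp [logMonomial, ht]

theorem logMonomial_mem (p : ℤ × ℕ) : logMonomial p ∈ logPoly :=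
  Submodule.subset_span ⟨p, rfl⟩

theorem logPoly_mul_mem {P Q : ℝ → ℝ} (hP : P ∈ logPoly) (hQ : Q ∈ logPoly) :
    P * Q ∈ logPoly := by
  refine Submodule.span_induction₂ (p := fun x y _ _ => x * y ∈ logPoly) ?_ ?_ ?_ ?_ ?_ ?_ ?_ hP hQ
  · rintro _ _ ⟨p, rfl⟩ ⟨q, rfl⟩
    rw [logMonomial_mul]
    exact logMonomial_mem _
  · intro y _; simp
  · intro x _; simp
  · intro x y z _ _ _ h₁ h₂; rw [add_mul]; exact add_mem h₁ h₂
  · intro x y z _ _ _ h₁ h₂; rw [mul_add]; exact add_mem h₁ h₂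
  · intro r x y _ _ h; rw [smul_mul_assoc]; exact Submodule.smul_mem _ _ h
  · intro r x y _ _ h; rw [mul_smul_comm]; exact Submodule.smul_mem _ _ h

theorem hasDerivAt_logMonomial (a : ℤ) (b : ℕ) {t : ℝ} (ht : 0 < t) :
    HasDerivAt (logMonomial (a, b))
      (a * logMonomial (a - 1, b) t + b * logMonomial (a - 1, b - 1) t) t := by
  have h : HasDerivAt (fun u : ℝ => u ^ a * Real.log u ^ b)
      (a * t ^ (a - 1) * Real.log t ^ b + t ^ a * (b * Real.log t ^ (b - 1) * t⁻¹)) t :=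
    (hasDerivAt_zpow a t (Or.inl ht.ne')).mul ((Real.hasDerivAt_log ht.ne').pow b)
  have he : logMonomial (a, b) =ᶠ[𝓝 t] fun u : ℝ => u ^ a * Real.log u ^ b := by
    filter_upwards [lt_mem_nhds ht] with u hu using logMonomial_of_pos _ hu
  refine (h.congr_of_eventuallyEq he).congr_deriv ?_
  simp only [logMonomial_of_pos _ ht, zpow_sub_one₀ ht.ne']
  ring

theorem continuousOn_of_mem_logPoly {P : ℝ → ℝ} (hP : P ∈ logPoly) : ContinuousOn P (Ioi 0) := by
  induction hP using Submodule.span_induction with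
  | mem x hx =>
    obtain ⟨p, rfl⟩ := hx
    exact fun t ht => (hasDerivAt_logMonomial p.1 p.2 ht).continuousAt.continuousWithinAt
  | zero => exact continuousOn_const
  | add x y _ _ hx hy => exact hx.add hy
  | smul r x _ hx => exact hx.const_smul r

/-- Integration by parts lowers the power of the logarithm when a ≠ -1. For a = -1 the
antiderivative is a multiple of the next power of the logarithm, so powers of t alone would not be
closed under integration. -/
theorem exists_antideriv_logMonomial (a : ℤ) (b : ℕ) :
    ∃ Q ∈ logPoly, ∀ t : ℝ, 0 < t → HasDerivAt Q (logMonomial (a, b) t) t := by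
  by_cases ha : a = -1
  · subst ha
    refine ⟨((b : ℝ) + 1)⁻¹ • logMonomial (0, b + 1),
      Submodule.smul_mem _ _ (logMonomial_mem _), fun t ht => ?_⟩
    refine ((hasDerivAt_logMonomial 0 (b + 1) ht).const_smul _).congr_deriv ?_
    have : (b : ℝ) + 1 ≠ 0 := by positivity
    simp
    field_simp
  · have ha' : (a : ℝ) + 1 ≠ 0 := by
      have : a + 1 ≠ 0 := by omega
      exact_mod_cast this
    induction b with
    | zero =>
      refine ⟨((a : ℝ) + 1)⁻¹ • logMonomial (a + 1, 0),
        Submodule.smul_mem _ _ (logMonomial_mem _), fun t ht => ?_⟩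
      refine ((hasDerivAt_logMonomial (a + 1) 0 ht).const_smul _).congr_deriv ?_
      simp
      field_simp
    | succ b ih =>
      obtain ⟨Q, hQ, hd⟩ := ih
      refine ⟨((a : ℝ) + 1)⁻¹ • (logMonomial (a + 1, b + 1) - ((b : ℝ) + 1) • Q),
        Submodule.smul_mem _ _ (sub_mem (logMonomial_mem _) (Submodule.smul_mem _ _ hQ)),
        fun t ht => ?_⟩
      refine (((hasDerivAt_logMonomial (a + 1) (b + 1) ht).sub
        ((hd t ht).const_smul ((b : ℝ) + 1))).const_smul _).congr_deriv ?_
      simp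
      field_simp

theorem exists_antideriv_of_mem_logPoly {P : ℝ → ℝ} (hP : P ∈ logPoly) :
    ∃ Q ∈ logPoly, ∀ t : ℝ, 0 < t → HasDerivAt Q (P t) t := by
  induction hP using Submodule.span_induction with
  | mem x hx =>
    obtain ⟨p, rfl⟩ := hx
    exact exists_antideriv_logMonomial p.1 p.2
  | zero => exact ⟨0, zero_mem _, fun t _ => hasDerivAt_const t (0 : ℝ)⟩
  | add x y _ _ hx hy =>
    obtain ⟨Q, hQ, hd⟩ := hx
    obtain ⟨R, hR, he⟩ := hy
    exact ⟨Q + R, add_mem hQ hR, fun t ht => (hd t ht).add (he t ht)⟩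
  | smul r x _ hx =>
    obtain ⟨Q, hQ, hd⟩ := hx
    exact ⟨r • Q, Submodule.smul_mem _ _ hQ, fun t ht => (hd t ht).const_smul r⟩

/-- `f` has an asymptotic expansion at `0` from the right, to every order, in the functions
`t ^ i * (log t) ^ j`. -/
def HasLogExpansion (f : ℝ → ℝ) : Prop :=
  ∀ M : ℕ, ∃ P ∈ logPoly, (fun t => f t - P t) =O[𝓝[>] 0] fun t : ℝ => t ^ M

theorem HasLogExpansion.add {f g : ℝ → ℝ} (hf : HasLogExpansion f) (hg : HasLogExpansion g) :
    HasLogExpansion (fun t => f t + g t) := by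
  intro M
  obtain ⟨P, hP, h⟩ := hf M
  obtain ⟨Q, hQ, h'⟩ := hg M
  refine ⟨P + Q, add_mem hP hQ, (h.add h').congr_left fun t => ?_⟩
  simp only [Pi.add_apply]
  ring

theorem HasLogExpansion.const_mul {f : ℝ → ℝ} (hf : HasLogExpansion f) (c : ℝ) :
    HasLogExpansion (fun t => c * f t) := by
  intro M
  obtain ⟨P, hP, h⟩ := hf M
  refine ⟨c • P, Submodule.smul_mem _ _ hP, (h.const_mul_left c).congr_left fun t => ?_⟩
  simp only [Pi.smul_apply, smul_eq_mul]
  ring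

theorem hasLogExpansion_pow (n : ℕ) : HasLogExpansion (fun t => t ^ n) := by
  intro M
  refine ⟨logMonomial (n, 0), logMonomial_mem _, ?_⟩
  refine (isBigO_zero (fun t : ℝ => t ^ M) (𝓝[>] 0)).congr' ?_ EventuallyEq.rfl
  filter_upwards [self_mem_nhdsWithin] with t ht
  simp [logMonomial_of_pos _ ht]

theorem isBigO_rpow_zero_of_le {a b : ℝ} (h : a ≤ b) :
    (fun t : ℝ => t ^ b) =O[𝓝[>] 0] fun t : ℝ => t ^ a := by
  refine IsBigO.of_bound 1 ?_
  filter_upwards [self_mem_nhdsWithin, Ioo_mem_nhdsGT (zero_lt_one' ℝ)] with t ht h1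
  have ht : 0 < t := ht
  rw [one_mul, Real.norm_of_nonneg (by positivity), Real.norm_of_nonneg (by positivity)]
  exact Real.rpow_le_rpow_of_exponent_ge ht h1.2.le h

/-- From f g - P Q = (f - P) g + (g - Q) P: an error of one factor is multiplied by the size of the
other. If both factors are O(t^(-K)), expansions to order M + K suffice; the bound on P follows from
those on f and f - P. -/
theorem HasLogExpansion.mul {f g : ℝ → ℝ} (hf : HasLogExpansion f) (hg : HasLogExpansion g)
    {a b : ℝ} (hfa : f =O[𝓝[>] 0] fun t : ℝ => t ^ a) (hgb : g =O[𝓝[>] 0] fun t : ℝ => t ^ b) :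
    HasLogExpansion (fun t => f t * g t) := by
  intro M
  obtain ⟨K, hK⟩ := exists_nat_ge (max |a| |b|)
  have hKa : -(K : ℝ) ≤ a := by linarith [neg_abs_le a, le_max_left |a| |b|]
  have hKb : -(K : ℝ) ≤ b := by linarith [neg_abs_le b, le_max_right |a| |b|]
  obtain ⟨P, hP, h⟩ := hf (M + K)
  obtain ⟨Q, hQ, h'⟩ := hg (M + K)
  refine ⟨P * Q, logPoly_mul_mem hP hQ, ?_⟩
  have hpow : (fun t : ℝ => t ^ (M + K)) =ᶠ[𝓝[>] 0] fun t : ℝ => t ^ ((M + K : ℕ) : ℝ) :=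
    Eventually.of_forall fun t => (Real.rpow_natCast t _).symm
  have hfK := hfa.trans (isBigO_rpow_zero_of_le hKa)
  have hgK := hgb.trans (isBigO_rpow_zero_of_le hKb)
  have hMK : -(K : ℝ) ≤ ((M + K : ℕ) : ℝ) := by
    have h1 : (0 : ℝ) ≤ K := K.cast_nonneg
    have h2 : (0 : ℝ) ≤ ((M + K : ℕ) : ℝ) := (M + K).cast_nonneg
    linarith
  have h₀ : (fun t => f t - P t) =O[𝓝[>] 0] fun t : ℝ => t ^ (-(K : ℝ)) :=
    (h.trans_eventuallyEq hpow).trans (isBigO_rpow_zero_of_le hMK)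
  have hPK : P =O[𝓝[>] 0] fun t : ℝ => t ^ (-(K : ℝ)) :=
    (hfK.sub h₀).congr_left fun t => by ring
  have hprod : ∀ᶠ t : ℝ in 𝓝[>] 0, t ^ (M + K) * t ^ (-(K : ℝ)) = t ^ M := by
    filter_upwards [self_mem_nhdsWithin] with t ht
    have ht : 0 < t := ht
    rw [Real.rpow_neg ht.le, Real.rpow_natCast, pow_add]
    field_simp
  have h₁ := (h.mul hgK).trans_eventuallyEq hprod
  have h₂ := ((h'.mul hPK)).trans_eventuallyEq hprod
  refine (h₁.add h₂).congr_left fun t => ?_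
  simp only [Pi.mul_apply]
  ring

theorem hasLogExpansion_of_analyticAt {f : ℝ → ℝ} (hf : AnalyticAt ℝ f 0) :
    HasLogExpansion f := by
  intro M
  obtain ⟨p, hp⟩ := hf
  refine ⟨∑ i ∈ Finset.range M, p.coeff i • logMonomial (i, 0),
    sum_mem fun i _ => Submodule.smul_mem _ _ (logMonomial_mem _), ?_⟩
  have h := (hp.isBigO_sub_partialSum_pow M).mono (nhdsWithin_le_nhds (s := Ioi 0))
  refine h.congr' ?_ ?_
  · filter_upwards [self_mem_nhdsWithin] with t ht
    have ht : 0 < t := ht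
    simp [FormalMultilinearSeries.partialSum, logMonomial_of_pos _ ht, mul_comm]
  · filter_upwards [self_mem_nhdsWithin] with t ht
    have ht : 0 < t := ht
    rw [Real.norm_of_nonneg ht.le]

/-- The kernel `1 / (e ^ t - 1)`. -/
noncomputable def boseKernel (t : ℝ) : ℝ := 1 / (Real.exp t - 1)

theorem boseKernel_pos {t : ℝ} (ht : 0 < t) : 0 < boseKernel t :=
  one_div_pos.2 (sub_pos.2 (Real.one_lt_exp_iff.2 ht))

/-- The kernel is t⁻¹ times the inverse of (e^t - 1)/t, and the latter extends analytically to 0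
with value 1 there. -/
theorem hasLogExpansion_boseKernel : HasLogExpansion boseKernel := by
  obtain ⟨p, hp⟩ := analyticAt_rexp (x := (0 : ℝ))
  have hd : AnalyticAt ℝ (dslope Real.exp 0) 0 := ⟨_, hp.has_fpower_series_dslope_fslope⟩
  have h0 : dslope Real.exp 0 0 ≠ 0 := by simp
  have h := hasLogExpansion_of_analyticAt (hd.inv h0)
  have hinv : HasLogExpansion (fun t : ℝ => t⁻¹) := by
    intro M
    refine ⟨logMonomial (-1, 0), logMonomial_mem _, ?_⟩
    refine (isBigO_zero (fun t : ℝ => t ^ M) (𝓝[>] 0)).congr' ?_ EventuallyEq.rfl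
    filter_upwards [self_mem_nhdsWithin] with t ht
    simp [logMonomial_of_pos _ ht]
  have hb : (dslope Real.exp 0)⁻¹ =O[𝓝[>] 0] fun t : ℝ => t ^ (0 : ℝ) := by
    simp only [Real.rpow_zero]
    exact ((hd.inv h0).continuousAt.tendsto.mono_left nhdsWithin_le_nhds).isBigO_one ℝ
  have hi : (fun t : ℝ => t⁻¹) =O[𝓝[>] 0] fun t : ℝ => t ^ (-1 : ℝ) :=
    (isBigO_refl _ _).congr_right fun t => (Real.rpow_neg_one t).symm
  intro M
  obtain ⟨P, hP, hO⟩ := hinv.mul h hi hb M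
  refine ⟨P, hP, hO.congr' ?_ EventuallyEq.rfl⟩
  filter_upwards [self_mem_nhdsWithin] with t ht
  have ht : t ≠ 0 := ne_of_gt ht
  simp [boseKernel, dslope_of_ne _ ht, slope_def_field]
  field_simp

/-! ### Tame functions: closure under algebraic operations. -/

/-- `f` is continuous on the positive half-line, has order at least `a` at `0` and exponential
decay rate at least `b` at `∞`, each up to an arbitrarily small loss in the exponent, and has an
asymptotic expansion at `0` in the functions `t ^ i * (log t) ^ j`. -/
structure IsTame (a b : ℝ) (f : ℝ → ℝ) : Prop where
  continuousOn : ContinuousOn f (Ioi 0)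
  zero : ∀ c < a, f =O[𝓝[>] 0] fun t : ℝ => t ^ c
  top : ∀ c < b, f =O[atTop] fun t : ℝ => Real.exp (-c * t)
  expansion : HasLogExpansion f

theorem eventuallyEq_zero_of_eqOn {f g : ℝ → ℝ} (h : EqOn f g (Ioi 0)) : f =ᶠ[𝓝[>] 0] g :=
  h.eventuallyEq_of_mem self_mem_nhdsWithin

theorem eventuallyEq_top_of_eqOn {f g : ℝ → ℝ} (h : EqOn f g (Ioi 0)) : f =ᶠ[atTop] g :=
  h.eventuallyEq_of_mem (Ioi_mem_atTop 0)

theorem isBigO_exp_top_of_le {a b : ℝ} (h : a ≤ b) :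
    (fun t : ℝ => Real.exp (-b * t)) =O[atTop] fun t : ℝ => Real.exp (-a * t) := by
  refine IsBigO.of_bound 1 ?_
  filter_upwards [Ioi_mem_atTop 0] with t ht
  have ht : 0 < t := ht
  simp only [one_mul, Real.norm_eq_abs, Real.abs_exp, Real.exp_le_exp]
  nlinarith

namespace IsTame

variable {a b a' b' : ℝ} {f g : ℝ → ℝ}

theorem congr (hf : IsTame a b f) (h : EqOn f g (Ioi 0)) : IsTame a b g where
  continuousOn := hf.continuousOn.congr h.symm
  zero c hc := (hf.zero c hc).congr' (eventuallyEq_zero_of_eqOn h) EventuallyEq.rfl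
  top c hc := (hf.top c hc).congr' (eventuallyEq_top_of_eqOn h) EventuallyEq.rfl
  expansion M := by
    obtain ⟨P, hP, hO⟩ := hf.expansion M
    refine ⟨P, hP, hO.congr' ?_ EventuallyEq.rfl⟩
    filter_upwards [eventuallyEq_zero_of_eqOn h] with t ht
    rw [ht]

theorem mono (hf : IsTame a b f) (ha : a' ≤ a) (hb : b' ≤ b) : IsTame a' b' f where
  continuousOn := hf.continuousOn
  zero c hc := hf.zero c (hc.trans_le ha)
  top c hc := hf.top c (hc.trans_le hb)
  expansion := hf.expansion

theorem add (hf : IsTame a b f) (hg : IsTame a b g) : IsTame a b (fun t => f t + g t) where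
  continuousOn := hf.continuousOn.add hg.continuousOn
  zero c hc := (hf.zero c hc).add (hg.zero c hc)
  top c hc := (hf.top c hc).add (hg.top c hc)
  expansion := hf.expansion.add hg.expansion

theorem const_mul (hf : IsTame a b f) (c : ℝ) : IsTame a b (fun t => c * f t) where
  continuousOn := continuousOn_const.mul hf.continuousOn
  zero d hd := (hf.zero d hd).const_mul_left c
  top d hd := (hf.top d hd).const_mul_left c
  expansion := hf.expansion.const_mul c

theorem sub (hf : IsTame a b f) (hg : IsTame a b g) : IsTame a b (fun t => f t - g t) :=
  (hf.add (hg.const_mul (-1))).congr fun t _ => by ring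

theorem mul (hf : IsTame a b f) (hg : IsTame a' b' g) :
    IsTame (a + a') (b + b') (fun t => f t * g t) where
  continuousOn := hf.continuousOn.mul hg.continuousOn
  zero c hc := by
    -- The slack a + a' - c is split evenly between the two factors.
    have h := (hf.zero (a - (a + a' - c) / 2) (by linarith)).mul
      (hg.zero (a' - (a + a' - c) / 2) (by linarith))
    refine h.trans_eventuallyEq ?_
    filter_upwards [self_mem_nhdsWithin] with t ht
    rw [← Real.rpow_add ht]
    ring_nf
  top c hc := by
    have h := (hf.top (b - (b + b' - c) / 2) (by linarith)).mul
      (hg.top (b' - (b + b' - c) / 2) (by linarith))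
    refine h.congr_right fun t => ?_
    rw [← Real.exp_add]
    ring_nf
  expansion := hf.expansion.mul hg.expansion (hf.zero (a - 1) (by linarith))
    (hg.zero (a' - 1) (by linarith))

/-- Order 0 is far from sharp at 0 but is all that is needed, and `IsTame 0 0` is closed under
products. The polynomial growth at infinity is absorbed by the permitted loss in the exponential
rate. -/
theorem pow (n : ℕ) : IsTame 0 0 (fun t => t ^ n) where
  continuousOn := (continuous_pow n).continuousOn
  zero c hc := by
    have h := isBigO_rpow_zero_of_le (a := c) (b := n) (hc.le.trans n.cast_nonneg)
    exact h.congr_left fun t => Real.rpow_natCast t n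
  top c hc := by
    have h := (isLittleO_pow_exp_pos_mul_atTop (k := n) (neg_pos.2 hc)).isBigO
    exact h
  expansion := hasLogExpansion_pow n

theorem const (c : ℝ) : IsTame 0 0 (fun _ => c) :=
  ((pow 0).const_mul c).congr fun t _ => by simp

theorem zero_fun : IsTame a b (fun _ => 0) where
  continuousOn := continuousOn_const
  zero _ _ := isBigO_zero _ _
  top _ _ := isBigO_zero _ _
  expansion := (const 0).expansion

theorem sum {ι : Type*} (s : Finset ι) {F : ι → ℝ → ℝ} (h : ∀ i ∈ s, IsTame a b (F i)) :
    IsTame a b (fun t => ∑ i ∈ s, F i t) := by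
  classical
  induction s using Finset.induction_on with
  | empty => exact zero_fun.congr fun t _ => by simp
  | insert i s hi ih =>
    refine ((h i (by simp)).add (ih fun j hj => h j (by simp [hj]))).congr fun t _ => ?_
    simp [hi]

theorem prod {ι : Type*} (s : Finset ι) {F : ι → ℝ → ℝ} (h : ∀ i ∈ s, IsTame 0 0 (F i)) :
    IsTame 0 0 (fun t => ∏ i ∈ s, F i t) := by
  classical
  induction s using Finset.induction_on with
  | empty => exact (const 1).congr fun t _ => by simp
  | insert i s hi ih =>
    refine (((h i (by simp)).mul (ih fun j hj => h j (by simp [hj]))).mono (by simp)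
      (by simp)).congr fun t _ => ?_
    simp [hi]

theorem boseKernel : IsTame (-1) 1 boseKernel where
  continuousOn := by
    refine continuousOn_const.div (Real.continuous_exp.sub continuous_const).continuousOn ?_
    intro t ht
    exact (sub_pos.2 (Real.one_lt_exp_iff.2 ht)).ne'
  zero c hc := by
    refine IsBigO.trans ?_ (isBigO_rpow_zero_of_le hc.le)
    refine IsBigO.of_bound 1 ?_
    filter_upwards [self_mem_nhdsWithin] with t ht
    have ht : 0 < t := ht
    rw [Real.norm_of_nonneg (boseKernel_pos ht).le, one_mul, Real.norm_of_nonneg (by positivity),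
      Real.rpow_neg_one, _root_.boseKernel, ← one_div]
    exact one_div_le_one_div_of_le ht (by linarith [Real.add_one_le_exp t])
  top c hc := by
    refine IsBigO.trans ?_ (isBigO_exp_top_of_le hc.le)
    refine IsBigO.of_bound 2 ?_
    filter_upwards [Ioi_mem_atTop 1] with t ht
    have ht : 1 < t := ht
    rw [Real.norm_of_nonneg (boseKernel_pos (by linarith)).le, Real.norm_of_nonneg (by positivity),
      _root_.boseKernel, neg_one_mul, Real.exp_neg, ← div_eq_mul_inv]
    have h2 : 2 ≤ Real.exp t := by linarith [Real.add_one_le_exp t]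
    rw [div_le_div_iff₀ (by linarith) (by linarith)]
    linarith
  expansion := hasLogExpansion_boseKernel

end IsTame

/-! ### Tail integrals of tame functions. -/

/-- The tail integral `t ↦ ∫_t^∞ f`. -/
noncomputable def tailIntegral (f : ℝ → ℝ) (t : ℝ) : ℝ := ∫ u in Ioi t, f u

theorem tailIntegral_congr {f g : ℝ → ℝ} (h : EqOn f g (Ioi 0)) :
    EqOn (tailIntegral f) (tailIntegral g) (Ioi 0) := fun _ ht =>
  setIntegral_congr_fun measurableSet_Ioi fun _ hu => h (mem_Ioi.2 (lt_trans (mem_Ioi.1 ht) hu))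

namespace IsTame

variable {a b : ℝ} {f g : ℝ → ℝ}

theorem integrableOn_Ioi (hf : IsTame a b f) (hb : 0 < b) {t : ℝ} (ht : 0 < t) :
    IntegrableOn f (Ioi t) :=
  integrable_of_isBigO_exp_neg (half_pos hb)
    (hf.continuousOn.mono fun _ hu => lt_of_lt_of_le ht hu) (hf.top _ (half_lt_self hb))

theorem tailIntegral_eq (hf : IsTame a b f) (hb : 0 < b) {s t : ℝ} (hs : 0 < s) (ht : 0 < t) :
    tailIntegral f t = tailIntegral f s - ∫ u in s..t, f u := by
  have h := intervalIntegral.integral_interval_add_Ioi (hf.integrableOn_Ioi hb hs)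
    (hf.integrableOn_Ioi hb ht)
  rw [tailIntegral, tailIntegral, ← h]
  ring

theorem hasDerivAt_tailIntegral (hf : IsTame a b f) (hb : 0 < b) {t : ℝ} (ht : 0 < t) :
    HasDerivAt (tailIntegral f) (-f t) t := by
  have h : HasDerivAt (fun x => ∫ u in t..x, f u) (f t) t :=
    intervalIntegral.integral_hasDerivAt_right (by simp)
      (hf.continuousOn.stronglyMeasurableAtFilter isOpen_Ioi t ht)
      (hf.continuousOn.continuousAt (Ioi_mem_nhds ht))
  refine (h.const_sub (tailIntegral f t)).congr_of_eventuallyEq ?_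
  filter_upwards [lt_mem_nhds ht] with x hx using hf.tailIntegral_eq hb ht hx

theorem tailIntegral_add (hf : IsTame a b f) (hg : IsTame a b g) (hb : 0 < b) :
    EqOn (tailIntegral fun t => f t + g t) (fun t => tailIntegral f t + tailIntegral g t)
      (Ioi 0) := fun _ ht =>
  integral_add (hf.integrableOn_Ioi hb ht) (hg.integrableOn_Ioi hb ht)

theorem tailIntegral_top (hf : IsTame a b f) {c : ℝ} (hc0 : 0 < c) (hc : c < b) :
    tailIntegral f =O[atTop] fun t : ℝ => Real.exp (-c * t) := by
  obtain ⟨K, hK⟩ := (hf.top c hc).bound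
  obtain ⟨T, hT⟩ := eventually_atTop.1 hK
  refine IsBigO.of_bound (K / c) ?_
  filter_upwards [eventually_ge_atTop T] with t ht
  have hi : IntegrableOn (fun u : ℝ => K * Real.exp (-c * u)) (Ioi t) :=
    (integrableOn_exp_mul_Ioi (neg_lt_zero.2 hc0) t).const_mul K
  calc ‖tailIntegral f t‖ ≤ ∫ u in Ioi t, K * Real.exp (-c * u) := by
        refine norm_integral_le_of_norm_le hi ?_
        filter_upwards [ae_restrict_mem measurableSet_Ioi] with u hu
        have h := hT u (ht.trans (le_of_lt hu))
        rwa [Real.norm_of_nonneg (Real.exp_pos _).le] at h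
    _ = K / c * ‖Real.exp (-c * t)‖ := by
        rw [integral_const_mul, integral_exp_mul_Ioi (neg_lt_zero.2 hc0),
          Real.norm_of_nonneg (Real.exp_pos _).le]
        field_simp

/-- Integrating a bound t⁻¹ would yield a logarithm. The permitted loss avoids this: f = O(t^(c-1))
with c < 0 integrates to O(t^c) near 0, and the rest of the integral is a constant. -/
theorem tailIntegral_zero (hf : IsTame (-1) b f) (hb : 0 < b) {c : ℝ} (hc : c < 0) :
    tailIntegral f =O[𝓝[>] 0] fun t : ℝ => t ^ c := by
  obtain ⟨K, hK⟩ := (hf.zero (c - 1) (by linarith)).bound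
  obtain ⟨δ, hδ, hδK⟩ := mem_nhdsGT_iff_exists_Ioc_subset.1 hK
  have hδ : 0 < δ := hδ
  have hδK' : ∀ u, 0 < u → u ≤ δ → ‖f u‖ ≤ K * u ^ (c - 1) := fun u h1 h2 => by
    have h : ‖f u‖ ≤ K * ‖u ^ (c - 1)‖ := hδK ⟨h1, h2⟩
    rwa [Real.norm_of_nonneg (Real.rpow_nonneg h1.le _)] at h
  have hK0 : 0 ≤ K := by
    have h := (norm_nonneg _).trans (hδK' δ hδ le_rfl)
    exact nonneg_of_mul_nonneg_left h (by positivity)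
  have h1 : (fun _ : ℝ => tailIntegral f δ) =O[𝓝[>] 0] fun t : ℝ => t ^ c :=
    (isBigO_const_const _ one_ne_zero _).trans
      ((isBigO_rpow_zero_of_le hc.le).congr_left fun t => Real.rpow_zero t)
  have h2 : (fun t => ∫ u in t..δ, f u) =O[𝓝[>] 0] fun t : ℝ => t ^ c := by
    refine IsBigO.of_bound (K / (-c)) ?_
    filter_upwards [Ioo_mem_nhdsGT hδ] with t ht
    have h0 : (0 : ℝ) ∉ uIcc t δ := by
      rw [uIcc_of_le ht.2.le]; exact fun h => absurd h.1 (not_le.2 ht.1)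
    have hint : IntervalIntegrable (fun u : ℝ => K * u ^ (c - 1)) volume t δ :=
      (intervalIntegral.intervalIntegrable_rpow (Or.inr h0)).const_mul K
    calc ‖∫ u in t..δ, f u‖ ≤ ∫ u in t..δ, K * u ^ (c - 1) := by
          refine intervalIntegral.norm_integral_le_of_norm_le ht.2.le ?_ hint
          exact Eventually.of_forall fun u hu => hδK' u (ht.1.trans hu.1) hu.2
      _ = K / (-c) * (t ^ c - δ ^ c) := by
          rw [intervalIntegral.integral_const_mul,
            integral_rpow (Or.inr ⟨by linarith, h0⟩), sub_add_cancel]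
          have : c ≠ 0 := hc.ne
          field_simp
          ring
      _ ≤ K / (-c) * ‖t ^ c‖ := by
          have := Real.rpow_nonneg hδ.le c
          have h4 : 0 ≤ K / (-c) := div_nonneg hK0 (by linarith)
          rw [Real.norm_of_nonneg (Real.rpow_nonneg ht.1.le c)]
          gcongr
          linarith
  refine (h1.add h2).congr' ?_ EventuallyEq.rfl
  filter_upwards [self_mem_nhdsWithin] with t ht
  rw [hf.tailIntegral_eq hb ht hδ]
  ring

/-- With f = P + R and Q an antiderivative of P, the tail integral is a constant minus Q(t) minus
the integral of R over (0,t]. The last term is O(t^(M+1)), so the expansion does not lose order. -/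
theorem hasLogExpansion_tailIntegral (hf : IsTame a b f) (hb : 0 < b) :
    HasLogExpansion (tailIntegral f) := by
  intro M
  obtain ⟨P, hP, hO⟩ := hf.expansion M
  obtain ⟨Q, hQ, hd⟩ := exists_antideriv_of_mem_logPoly hP
  have hPc := continuousOn_of_mem_logPoly hP
  set R : ℝ → ℝ := fun t => f t - P t with hR
  have hRc : ContinuousOn R (Ioi 0) := hf.continuousOn.sub hPc
  obtain ⟨K, hK⟩ := hO.bound
  obtain ⟨δ, hδ, hδK⟩ := mem_nhdsGT_iff_exists_Ioc_subset.1 hK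
  have hδ : 0 < δ := hδ
  have hδK' : ∀ u, 0 < u → u ≤ δ → ‖R u‖ ≤ K * u ^ M := fun u h1 h2 => by
    have h : ‖R u‖ ≤ K * ‖u ^ M‖ := hδK ⟨h1, h2⟩
    rwa [Real.norm_of_nonneg (pow_nonneg h1.le _)] at h
  have hRi : IntegrableOn R (Ioc 0 δ) := by
    refine Integrable.mono' (g := fun u => K * u ^ M) ?_
      ((hRc.mono fun u hu => hu.1).aestronglyMeasurable measurableSet_Ioc) ?_
    · exact ((continuous_pow M).const_mul K |>.integrableOn_Icc (a := 0) (b := δ)).mono_set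
        Ioc_subset_Icc_self
    · filter_upwards [ae_restrict_mem measurableSet_Ioc] with u hu using hδK' u hu.1 hu.2
  have hRI : ∀ t, 0 < t → t ≤ δ → IntervalIntegrable R volume 0 t := fun t h1 h2 =>
    (intervalIntegrable_iff_integrableOn_Ioc_of_le h1.le).2
      (hRi.mono_set (Ioc_subset_Ioc_right h2))
  -- All contributions that do not depend on t; the expansion is C - Q.
  set C : ℝ := tailIntegral f δ + Q δ + ∫ u in (0)..δ, R u
  refine ⟨C • logMonomial (0, 0) - Q, sub_mem (Submodule.smul_mem _ _ (logMonomial_mem _)) hQ, ?_⟩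
  refine IsBigO.of_bound (K * δ) ?_
  filter_upwards [Ioo_mem_nhdsGT hδ, Ioo_mem_nhdsGT (zero_lt_one' ℝ)] with t ht ht1
  have hsub : uIcc t δ ⊆ Ioi 0 := by
    rw [uIcc_of_le ht.2.le]; exact fun u hu => ht.1.trans_le hu.1
  have e1 : tailIntegral f t = tailIntegral f δ + ∫ u in t..δ, f u := by
    rw [hf.tailIntegral_eq hb ht.1 hδ]; ring
  have e2 : ∫ u in t..δ, f u = (∫ u in t..δ, P u) + ∫ u in t..δ, R u := by
    rw [← intervalIntegral.integral_add (hPc.mono hsub).intervalIntegrable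
      (hRc.mono hsub).intervalIntegrable]
    simp [hR]
  have e3 : ∫ u in t..δ, P u = Q δ - Q t :=
    intervalIntegral.integral_eq_sub_of_hasDerivAt (fun u hu => hd u (hsub hu))
      (hPc.mono hsub).intervalIntegrable
  have e4 : ∫ u in t..δ, R u = (∫ u in (0)..δ, R u) - ∫ u in (0)..t, R u := by
    rw [← intervalIntegral.integral_add_adjacent_intervals (hRI t ht.1 ht.2.le)
      (hRc.mono hsub).intervalIntegrable]
    ring
  have e5 : tailIntegral f t - (C • logMonomial (0, 0) - Q) t = -∫ u in (0)..t, R u := by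
    simp only [Pi.sub_apply, Pi.smul_apply, smul_eq_mul, logMonomial_of_pos _ ht.1, zpow_zero,
      pow_zero, mul_one, C]
    rw [e1, e2, e3, e4]
    ring
  have hK0 : 0 ≤ K :=
    nonneg_of_mul_nonneg_left ((norm_nonneg _).trans (hδK' δ hδ le_rfl)) (by positivity)
  rw [e5, norm_neg, Real.norm_of_nonneg (pow_nonneg ht.1.le M)]
  have hb : ∀ u ∈ uIoc 0 t, ‖R u‖ ≤ K * t ^ M := fun u hu => by
    rw [uIoc_of_le ht.1.le] at hu
    refine (hδK' u hu.1 (hu.2.trans ht.2.le)).trans ?_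
    gcongr
    · exact hu.1.le
    · exact hu.2
  refine (intervalIntegral.norm_integral_le_of_norm_le_const hb).trans ?_
  rw [sub_zero, abs_of_pos ht.1]
  have h6 : 0 ≤ K * t ^ M := mul_nonneg hK0 (pow_nonneg ht.1.le M)
  calc K * t ^ M * t ≤ K * t ^ M * δ := by gcongr; exact ht.2.le
    _ = K * δ * t ^ M := by ring

theorem tailIntegral (hf : IsTame (-1) 1 f) : IsTame 0 1 (tailIntegral f) where
  continuousOn t ht :=
    (hf.hasDerivAt_tailIntegral one_pos ht).continuousAt.continuousWithinAt
  zero _ hc := hf.tailIntegral_zero one_pos hc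
  top c hc := by
    -- `tailIntegral_top` needs a positive rate, whereas c may be negative here.
    refine (hf.tailIntegral_top (c := max c (1 / 2)) (by positivity) (by simp [hc]; norm_num)).trans
      (isBigO_exp_top_of_le (le_max_left _ _))
  expansion := hf.hasLogExpansion_tailIntegral one_pos

end IsTame

theorem IsTame.tendsto_zero {a b : ℝ} {f : ℝ → ℝ} (hf : IsTame a b f) (hb : 0 < b) :
    Tendsto f atTop (𝓝 0) := by
  refine (hf.top _ (half_lt_self hb)).trans_tendsto ?_
  refine Real.tendsto_exp_atBot.comp ?_
  exact tendsto_id.const_mul_atTop_of_neg (by linarith)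

/-! ### Iterated integrals against 1/(e^t - 1). -/

/-- The operator `f ↦ ∫_t^∞ f(u) / (e^u - 1) du`. -/
noncomputable def boseTail (f : ℝ → ℝ) : ℝ → ℝ := tailIntegral (fun t => boseKernel t * f t)

theorem boseTail_congr {f g : ℝ → ℝ} (h : EqOn f g (Ioi 0)) :
    EqOn (boseTail f) (boseTail g) (Ioi 0) :=
  tailIntegral_congr fun t ht => by simp only [h ht]

theorem boseTail_iterate_congr {f g : ℝ → ℝ} (h : EqOn f g (Ioi 0)) (q : ℕ) :
    EqOn (boseTail^[q] f) (boseTail^[q] g) (Ioi 0) := by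
  induction q generalizing f g with
  | zero => exact h
  | succ q ih => simpa only [Function.iterate_succ_apply] using ih (boseTail_congr h)

/-- The kernel takes `IsTame 0 0` to `IsTame (-1) 1`, and a tail integral leads back, so every
iterated integral below converges and stays in the class. -/
theorem IsTame.boseKernel_mul {f : ℝ → ℝ} (hf : IsTame 0 0 f) :
    IsTame (-1) 1 (fun t => _root_.boseKernel t * f t) :=
  (IsTame.boseKernel.mul hf).mono (by simp) (by simp)

theorem IsTame.boseTail {f : ℝ → ℝ} (hf : IsTame 0 0 f) : IsTame 0 0 (boseTail f) :=
  hf.boseKernel_mul.tailIntegral.mono le_rfl zero_le_one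

theorem IsTame.boseTail_iterate {f : ℝ → ℝ} (hf : IsTame 0 0 f) (q : ℕ) :
    IsTame 0 0 (_root_.boseTail^[q] f) := by
  induction q generalizing f with
  | zero => exact hf
  | succ q ih => simpa only [Function.iterate_succ_apply] using ih hf.boseTail

theorem boseTail_const_mul (c : ℝ) (f : ℝ → ℝ) :
    boseTail (fun t => c * f t) = fun t => c * boseTail f t := by
  funext t
  simp only [boseTail, tailIntegral]
  rw [← integral_const_mul]
  congr 1
  funext u
  ring

theorem boseTail_add {f g : ℝ → ℝ} (hf : IsTame 0 0 f) (hg : IsTame 0 0 g) :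
    EqOn (boseTail fun t => f t + g t) (fun t => boseTail f t + boseTail g t) (Ioi 0) := by
  refine EqOn.trans (tailIntegral_congr fun t _ => ?_)
    (hf.boseKernel_mul.tailIntegral_add hg.boseKernel_mul one_pos)
  simp only [mul_add]

theorem boseTail_sum {ι : Type*} (s : Finset ι) (c : ι → ℝ) {F : ι → ℝ → ℝ}
    (h : ∀ i ∈ s, IsTame 0 0 (F i)) :
    EqOn (boseTail fun t => ∑ i ∈ s, c i * F i t) (fun t => ∑ i ∈ s, c i * boseTail (F i) t)
      (Ioi 0) := by
  classical
  induction s using Finset.induction_on with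
  | empty => intro t _; simp [boseTail, tailIntegral]
  | insert i s hi ih =>
    intro t ht
    simp only [Finset.sum_insert hi]
    rw [boseTail_add ((h i (by simp)).const_mul (c i))
      (IsTame.sum s fun j hj => (h j (by simp [hj])).const_mul (c j)) ht]
    simp only [boseTail_const_mul, ih (fun j hj => h j (by simp [hj])) ht]

theorem boseTail_iterate_sum {ι : Type*} (s : Finset ι) (c : ι → ℝ) {F : ι → ℝ → ℝ}
    (h : ∀ i ∈ s, IsTame 0 0 (F i)) (q : ℕ) :
    EqOn (boseTail^[q] fun t => ∑ i ∈ s, c i * F i t)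
      (fun t => ∑ i ∈ s, c i * boseTail^[q] (F i) t) (Ioi 0) := by
  induction q generalizing F with
  | zero => intro t _; rfl
  | succ q ih =>
    simp only [Function.iterate_succ_apply]
    exact (boseTail_iterate_congr (boseTail_sum s c h) q).trans
      (ih fun i hi => (h i hi).boseTail)

/-- The function obtained from `f` by applying in turn, for the entries `x` of the list, the
multiplication by `1 / (e ^ t - 1)` and the `x`-fold tail integral. -/
noncomputable def polyTail (f : ℝ → ℝ) (L : List ℕ) : ℝ → ℝ :=
  L.foldl (fun f x => tailIntegral^[x] (fun t => boseKernel t * f t)) f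

@[simp] theorem polyTail_nil (f : ℝ → ℝ) : polyTail f [] = f := rfl

@[simp] theorem polyTail_cons (f : ℝ → ℝ) (x : ℕ) (L : List ℕ) :
    polyTail f (x :: L) = polyTail (tailIntegral^[x] (fun t => boseKernel t * f t)) L := rfl

theorem polyTail_append (f : ℝ → ℝ) (L L' : List ℕ) :
    polyTail f (L ++ L') = polyTail (polyTail f L) L' := List.foldl_append

theorem polyTail_append_one (f : ℝ → ℝ) (L : List ℕ) :
    polyTail f (L ++ [1]) = boseTail (polyTail f L) := by
  rw [polyTail_append]
  rfl

theorem IsTame.tailIntegral_iterate {f : ℝ → ℝ} (hf : IsTame (-1) 1 f) (n : ℕ) :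
    IsTame 0 1 (_root_.tailIntegral^[n + 1] f) := by
  induction n generalizing f with
  | zero => exact hf.tailIntegral
  | succ n ih =>
    rw [Function.iterate_succ_apply]
    exact ih (hf.tailIntegral.mono (by norm_num) le_rfl)

theorem IsTame.polyTail {f : ℝ → ℝ} (hf : IsTame 0 0 f) {L : List ℕ} (hL : ∀ x ∈ L, 1 ≤ x) :
    IsTame 0 0 (polyTail f L) := by
  induction L generalizing f with
  | nil => exact hf
  | cons x L ih =>
    rw [polyTail_cons]
    refine ih ?_ fun y hy => hL y (by simp [hy])
    obtain ⟨n, rfl⟩ := Nat.exists_eq_add_of_le' (hL x (by simp))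
    exact (hf.boseKernel_mul.tailIntegral_iterate n).mono le_rfl zero_le_one

/-! ### Integration by parts against divided powers. -/

/-- The divided power `t ^ n / n!`. -/
noncomputable def dividedPower (n : ℕ) (t : ℝ) : ℝ := t ^ n / n.factorial

theorem IsTame.dividedPower (n : ℕ) : IsTame 0 0 (dividedPower n) :=
  ((IsTame.pow n).const_mul (n.factorial : ℝ)⁻¹).congr fun t _ => by
    simp only [_root_.dividedPower]
    ring

theorem dividedPower_zero (t : ℝ) : dividedPower 0 t = 1 := by simp [dividedPower]

theorem hasDerivAt_dividedPower (n : ℕ) (t : ℝ) :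
    HasDerivAt (dividedPower (n + 1)) (dividedPower n t) t := by
  refine ((hasDerivAt_pow (n + 1) t).div_const _).congr_deriv ?_
  rw [dividedPower, Nat.factorial_succ]
  have : (n.factorial : ℝ) ≠ 0 := by positivity
  push_cast
  field_simp

/-- One integration by parts: the tail integral of F has derivative -F, and the boundary term at
infinity vanishes by exponential decay. Divided powers keep the coefficients equal to 1. -/
theorem tailIntegral_dividedPower_succ_mul {F : ℝ → ℝ} (hF : IsTame (-1) 1 F) (N : ℕ) :
    EqOn (tailIntegral fun t => dividedPower (N + 1) t * F t)
      (fun t => dividedPower (N + 1) t * tailIntegral F t +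
        tailIntegral (fun u => dividedPower N u * tailIntegral F u) t) (Ioi 0) := by
  intro t ht
  have hJ := hF.tailIntegral
  have h1 : IsTame (-1) 1 fun t => dividedPower N t * tailIntegral F t :=
    ((IsTame.dividedPower N).mul hJ).mono (by norm_num) (by norm_num)
  have h2 : IsTame (-1) 1 fun t => dividedPower (N + 1) t * F t :=
    ((IsTame.dividedPower (N + 1)).mul hF).mono (by norm_num) (by norm_num)
  have h3 : IsTame 0 1 fun t => dividedPower (N + 1) t * tailIntegral F t :=
    ((IsTame.dividedPower (N + 1)).mul hJ).mono (by norm_num) (by norm_num)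
  have hd : ∀ u ∈ Ici t, HasDerivAt (fun t => dividedPower (N + 1) t * tailIntegral F t)
      (dividedPower N u * tailIntegral F u - dividedPower (N + 1) u * F u) u := fun u hu => by
    refine ((hasDerivAt_dividedPower N u).mul
      (hF.hasDerivAt_tailIntegral one_pos (lt_of_lt_of_le ht hu))).congr_deriv ?_
    ring
  have h := integral_Ioi_of_hasDerivAt_of_tendsto' hd
    ((h1.integrableOn_Ioi one_pos ht).sub (h2.integrableOn_Ioi one_pos ht))
    (h3.tendsto_zero one_pos)
  rw [integral_sub (h1.integrableOn_Ioi one_pos ht) (h2.integrableOn_Ioi one_pos ht)] at h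
  simp only [tailIntegral] at h ⊢
  linarith

theorem tailIntegral_dividedPower_mul (N : ℕ) {F : ℝ → ℝ} (hF : IsTame (-1) 1 F) :
    EqOn (tailIntegral fun t => dividedPower N t * F t)
      (fun t => ∑ p ∈ Finset.HasAntidiagonal.antidiagonal N,
        dividedPower p.2 t * tailIntegral^[p.1 + 1] F t) (Ioi 0) := by
  induction N generalizing F with
  | zero => intro t _; simp [dividedPower_zero]
  | succ N ih =>
    intro t ht
    rw [tailIntegral_dividedPower_succ_mul hF N ht]
    simp only [Finset.Nat.sum_antidiagonal_succ]
    rw [ih (hF.tailIntegral.mono (by norm_num) le_rfl) ht]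
    simp only [Function.iterate_succ_apply, zero_add, Function.iterate_zero_apply]

theorem sum_antidiagonalTuple_succ {M : Type*} [AddCommMonoid M] (k N : ℕ)
    (f : (Fin (k + 1) → ℕ) → M) :
    ∑ c ∈ Finset.Nat.antidiagonalTuple (k + 1) N, f c =
      ∑ p ∈ Finset.HasAntidiagonal.antidiagonal N, ∑ c ∈ Finset.Nat.antidiagonalTuple k p.2,
        f (Fin.cons p.1 c) := by
  rw [Finset.sum_sigma']
  refine Finset.sum_bij' (fun c _ => ⟨(c 0, ∑ i, Fin.tail c i), Fin.tail c⟩)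
    (fun x _ => Fin.cons x.1.1 x.2) ?_ ?_ ?_ ?_ ?_
  · intro c hc
    rw [Finset.Nat.mem_antidiagonalTuple, Fin.sum_univ_succ] at hc
    simp only [Finset.mem_sigma, Finset.HasAntidiagonal.mem_antidiagonal, Finset.Nat.mem_antidiagonalTuple]
    exact ⟨hc, trivial⟩
  · rintro ⟨⟨a, b⟩, c⟩ hx
    simp only [Finset.mem_sigma, Finset.HasAntidiagonal.mem_antidiagonal,
      Finset.Nat.mem_antidiagonalTuple] at hx
    simp [Finset.Nat.mem_antidiagonalTuple, Fin.sum_univ_succ, hx.2, hx.1]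
  · intro c _
    exact Fin.cons_self_tail c
  · rintro ⟨⟨a, b⟩, c⟩ hx
    simp only [Finset.mem_sigma, Finset.HasAntidiagonal.mem_antidiagonal,
      Finset.Nat.mem_antidiagonalTuple] at hx
    simp [hx.2]
  · intro c _
    exact congrArg f (Fin.cons_self_tail c).symm

/-- Each of the q operators trades some part c_u of the power of t for c_u additional tail
integrations, hence the entry c_u + 1; the part c_{q+1} remains as a power of t. The first operator
applied gives the first entry, so the induction peels off c_1 and generalizes over g. -/
theorem boseTail_iterate_dividedPower_mul (q N : ℕ) {g : ℝ → ℝ} (hg : IsTame 0 0 g) :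
    EqOn (boseTail^[q] fun t => dividedPower N t * g t)
      (fun t => ∑ c ∈ Finset.Nat.antidiagonalTuple (q + 1) N,
        dividedPower (c (Fin.last q)) t *
          polyTail g (List.ofFn fun u : Fin q => c u.castSucc + 1) t) (Ioi 0) := by
  induction q generalizing N g with
  | zero => intro t _; simp
  | succ q ih =>
    intro t ht
    have h1 : EqOn (boseTail fun t => dividedPower N t * g t) (fun t => ∑ p ∈ Finset.HasAntidiagonal.antidiagonal N,
        1 * (dividedPower p.2 t * tailIntegral^[p.1 + 1] (fun t => boseKernel t * g t) t))
        (Ioi 0) := by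
      refine EqOn.trans (tailIntegral_congr fun t _ => ?_)
        ((tailIntegral_dividedPower_mul N hg.boseKernel_mul).trans fun t _ => ?_)
      · ring
      · simp only [one_mul]
    have ht' : ∀ n, IsTame 0 0 (tailIntegral^[n + 1] (fun t => boseKernel t * g t)) := fun n =>
      (hg.boseKernel_mul.tailIntegral_iterate n).mono le_rfl zero_le_one
    rw [Function.iterate_succ_apply, boseTail_iterate_congr h1 q ht,
      boseTail_iterate_sum _ _ (fun p _ => ((IsTame.dividedPower p.2).mul (ht' p.1)).mono
        (by simp) (by simp)) q ht]
    simp only [one_mul]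
    rw [sum_antidiagonalTuple_succ]
    refine Finset.sum_congr rfl fun p _ => ?_
    rw [ih p.2 (ht' p.1) ht]
    refine Finset.sum_congr rfl fun c _ => ?_
    rw [← Fin.succ_last, Fin.cons_succ, List.ofFn_succ, polyTail_cons]
    simp only [Fin.castSucc_zero, Fin.cons_zero, ← Fin.succ_castSucc, Fin.cons_succ]

/-! ### Exponential series with nonnegative coefficients. -/

theorem hasSum_pi_prod {n : ℕ} {α : Fin n → Type*} (f : ∀ i, α i → ℝ) (a : Fin n → ℝ)
    (h0 : ∀ i x, 0 ≤ f i x) (h : ∀ i, HasSum (f i) (a i)) :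
    HasSum (fun m : ∀ i, α i => ∏ i, f i (m i)) (∏ i, a i) := by
  induction n with
  | zero =>
    simpa only [Finset.univ_eq_empty, Finset.prod_empty] using
      hasSum_unique (fun m : ∀ i, α i => ∏ i, f i (m i))
  | succ n ih =>
    set G : (∀ i : Fin n, α i.succ) → ℝ := fun m => ∏ i : Fin n, f i.succ (m i) with hG
    have h1 : HasSum G (∏ i : Fin n, a i.succ) :=
      ih (fun i => f i.succ) (fun i => a i.succ) (fun i => h0 i.succ) fun i => h i.succ
    have hG0 : ∀ m, 0 ≤ G m := fun m => Finset.prod_nonneg fun i _ => h0 i.succ _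
    have h2 := (h 0).mul h1 ((h 0).summable.mul_of_nonneg h1.summable (h0 0) hG0)
    rw [Fin.prod_univ_succ, ← (Fin.consEquiv α).hasSum_iff]
    refine h2.congr_fun ?_
    intro m
    simp [Fin.prod_univ_succ, Fin.consEquiv, hG]

/-- On the positive half-line `f` is the series `∑ c_i e ^ (-p_i t)` with nonnegative
coefficients. -/
structure IsExpSeries {ι : Type*} (c : ι → ℝ) (p : ι → ℕ) (f : ℝ → ℝ) : Prop where
  nonneg : ∀ i, 0 ≤ c i
  hasSum : ∀ t : ℝ, 0 < t → HasSum (fun i => c i * Real.exp (-p i * t)) (f t)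

namespace IsExpSeries

variable {ι κ : Type*} {c : ι → ℝ} {p : ι → ℕ} {f : ℝ → ℝ} {d : κ → ℝ} {q : κ → ℕ} {g : ℝ → ℝ}

theorem congr (h : IsExpSeries c p f) (hfg : EqOn f g (Ioi 0)) : IsExpSeries c p g :=
  ⟨h.nonneg, fun t ht => hfg ht ▸ h.hasSum t ht⟩

theorem reindex (h : IsExpSeries c p f) (e : ι ≃ κ) (hc : ∀ i, d (e i) = c i)
    (hp : ∀ i, q (e i) = p i) : IsExpSeries d q f where
  nonneg j := by
    obtain ⟨i, rfl⟩ := e.surjective j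
    exact hc i ▸ h.nonneg i
  hasSum t ht := by
    rw [← e.hasSum_iff]
    refine (h.hasSum t ht).congr_fun fun i => ?_
    simp only [Function.comp_apply, hc, hp]

theorem mul (hf : IsExpSeries c p f) (hg : IsExpSeries d q g) :
    IsExpSeries (fun x : ι × κ => c x.1 * d x.2) (fun x => p x.1 + q x.2)
      (fun t => f t * g t) where
  nonneg x := mul_nonneg (hf.nonneg _) (hg.nonneg _)
  hasSum t ht := by
    have h1 := hf.hasSum t ht
    have h2 := hg.hasSum t ht
    refine (h1.mul h2 (h1.summable.mul_of_nonneg h2.summable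
      (fun i => mul_nonneg (hf.nonneg i) (Real.exp_pos _).le)
      fun i => mul_nonneg (hg.nonneg i) (Real.exp_pos _).le)).congr_fun fun x => ?_
    rw [show -((p x.1 + q x.2 : ℕ) : ℝ) * t = -p x.1 * t + -q x.2 * t by push_cast; ring,
      Real.exp_add]
    ring

theorem pi_prod {n : ℕ} {α : Fin n → Type*} {c : ∀ i, α i → ℝ} {p : ∀ i, α i → ℕ}
    {f : Fin n → ℝ → ℝ} (h : ∀ i, IsExpSeries (c i) (p i) (f i)) :
    IsExpSeries (fun m : ∀ i, α i => ∏ i, c i (m i)) (fun m => ∑ i, p i (m i))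
      (fun t => ∏ i, f i t) where
  nonneg m := Finset.prod_nonneg fun i _ => (h i).nonneg _
  hasSum t ht := by
    refine (hasSum_pi_prod (fun i x => c i x * Real.exp (-p i x * t)) _
      (fun i x => mul_nonneg ((h i).nonneg x) (Real.exp_pos _).le)
      fun i => (h i).hasSum t ht).congr_fun fun m => ?_
    rw [Finset.prod_mul_distrib, ← Real.exp_sum]
    push_cast
    rw [← Finset.sum_mul, Finset.sum_neg_distrib]

theorem boseKernel : IsExpSeries (fun _ : ℕ+ => 1) (fun m => (m : ℕ)) boseKernel where
  nonneg _ := zero_le_one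
  hasSum t ht := by
    have hx : Real.exp (-t) < 1 := by simpa using ht
    have h := (hasSum_geometric_of_lt_one (Real.exp_pos (-t)).le hx).mul_left (Real.exp (-t))
    rw [← Equiv.pnatEquivNat.hasSum_iff] at h
    have hv : Real.exp (-t) * (1 - Real.exp (-t))⁻¹ = _root_.boseKernel t := by
      have h1 : Real.exp t - 1 ≠ 0 := (sub_pos.2 (Real.one_lt_exp_iff.2 ht)).ne'
      have h2 : 1 - Real.exp (-t) ≠ 0 := (sub_pos.2 hx).ne'
      rw [_root_.boseKernel, ← div_eq_mul_inv, div_eq_div_iff h2 h1, mul_sub, ← Real.exp_add]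
      simp
    rw [hv] at h
    refine h.congr_fun fun m => ?_
    have hm : ((m : ℕ) : ℝ) = (Equiv.pnatEquivNat m : ℝ) + 1 := by
      have := PNat.natPred_add_one m
      exact_mod_cast this.symm
    rw [Function.comp_apply, ← Real.exp_nat_mul, ← Real.exp_add, one_mul, hm]
    ring_nf

/-- Integrate termwise. The integrated terms remain summable because p ≥ 1 makes c/p at most c. -/
theorem tailIntegral [Countable ι] (hf : IsExpSeries c p f) (hp : ∀ i, 1 ≤ p i) :
    IsExpSeries (fun i => c i / p i) p (tailIntegral f) where
  nonneg i := div_nonneg (hf.nonneg i) (Nat.cast_nonneg _)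
  hasSum t h0 := by
    have hp' : ∀ i, -(p i : ℝ) < 0 := fun i => by
      have := hp i
      exact neg_lt_zero.2 (by positivity)
    have hint : ∀ i, IntegrableOn (fun u => c i * Real.exp (-p i * u)) (Ioi t) := fun i =>
      (integrableOn_exp_mul_Ioi (hp' i) t).const_mul _
    have hval : ∀ i, ∫ u in Ioi t, c i * Real.exp (-p i * u) =
        c i / p i * Real.exp (-p i * t) := fun i => by
      rw [integral_const_mul, integral_exp_mul_Ioi (hp' i)]
      have := (hp' i).ne
      field_simp
    have hsum : Summable fun i => c i / p i * Real.exp (-p i * t) := by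
      refine (hf.hasSum t h0).summable.of_nonneg_of_le
        (fun i => mul_nonneg (div_nonneg (hf.nonneg i) (Nat.cast_nonneg _)) (Real.exp_pos _).le)
        fun i => ?_
      refine mul_le_mul_of_nonneg_right ?_ (Real.exp_pos _).le
      exact div_le_self (hf.nonneg i) (by exact_mod_cast hp i)
    have h := hasSum_integral_of_summable_integral_norm hint (by
      refine hsum.congr fun i => ?_
      rw [← hval i]
      refine integral_congr_ae (Eventually.of_forall fun u => ?_)
      exact (Real.norm_of_nonneg (mul_nonneg (hf.nonneg i) (Real.exp_pos _).le)).symm)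
    have he : ∫ u in Ioi t, ∑' i, c i * Real.exp (-p i * u) = _root_.tailIntegral f t :=
      setIntegral_congr_fun measurableSet_Ioi fun u hu => (hf.hasSum u (h0.trans hu)).tsum_eq
    rw [he] at h
    exact h.congr_fun fun i => (hval i).symm

theorem tailIntegral_iterate [Countable ι] (hf : IsExpSeries c p f) (hp : ∀ i, 1 ≤ p i)
    (n : ℕ) :
    IsExpSeries (fun i => c i * (1 / (p i : ℝ) ^ n)) p (_root_.tailIntegral^[n] f) := by
  induction n generalizing c f with
  | zero => simpa using hf
  | succ n ih =>
    rw [Function.iterate_succ_apply]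
    convert! ih (hf.tailIntegral hp) using 2 with i
    rw [pow_succ]
    field_simp

theorem integrableOn_rpow_mul {σ : ℝ} (ht : IsTame (-1) 1 f) (hσ : 1 < σ) :
    IntegrableOn (fun t : ℝ => t ^ (σ - 1) * f t) (Ioi 0) := by
  -- Exponential decay allows any exponent above σ at infinity; the exponent at 0 is taken strictly
  -- between 1 and σ.
  refine mellin_convergent_of_isBigO_scalar (a := σ + 1) (b := 1 + (σ - 1) / 2)
    (ht.continuousOn.locallyIntegrableOn measurableSet_Ioi) ?_ (by linarith) ?_ (by linarith)
  · exact (ht.top (1 / 2) (by norm_num)).trans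
      (isLittleO_exp_neg_mul_rpow_atTop (by norm_num) _).isBigO
  · exact ht.zero _ (by linarith)

/-- Convergence of the Dirichlet series is read off from tameness, without estimating a multiple
sum: by nonnegativity, Γ(σ) times any finite partial sum is at most the convergent integral of
t^(σ-1) f(t). -/
theorem summable_div_rpow (hf : IsExpSeries c p f) (hp : ∀ i, 1 ≤ p i)
    (ht : IsTame (-1) 1 f) {σ : ℝ} (hσ : 1 < σ) : Summable fun i => c i / (p i : ℝ) ^ σ := by
  have hp' : ∀ i, 0 < (p i : ℝ) := fun i => by have := hp i; positivity
  have hval : ∀ i, ∫ t in Ioi (0 : ℝ), t ^ (σ - 1) * (c i * Real.exp (-p i * t)) =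
      Real.Gamma σ * (c i / (p i : ℝ) ^ σ) := fun i => by
    have h := Real.integral_rpow_mul_exp_neg_mul_Ioi (a := σ) (by linarith) (hp' i)
    have e : ∀ t : ℝ, t ^ (σ - 1) * (c i * Real.exp (-p i * t)) =
        c i * (t ^ (σ - 1) * Real.exp (-(p i * t))) := fun t => by rw [neg_mul]; ring
    simp only [e]
    rw [integral_const_mul, h, Real.div_rpow zero_le_one (hp' i).le, Real.one_rpow]
    ring
  have hint : ∀ i, IntegrableOn (fun t : ℝ => t ^ (σ - 1) * (c i * Real.exp (-p i * t)))
      (Ioi 0) := fun i => by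
    have h := (Real.GammaIntegral_convergent (s := σ) (by linarith))
    by_cases hc : c i = 0
    · simp [hc]
    -- The Bochner integral of a non-integrable function is 0, so a nonzero integral certifies
    -- integrability.
    · refine not_imp_comm.1 integral_undef ?_
      rw [hval]
      have := Real.Gamma_pos_of_pos (s := σ) (by linarith)
      have := hp' i
      positivity
  have hI := integrableOn_rpow_mul ht hσ
  have hΓ := Real.Gamma_pos_of_pos (s := σ) (by linarith)
  rw [← summable_mul_left_iff hΓ.ne']
  refine summable_of_sum_le (c := ∫ t in Ioi (0 : ℝ), t ^ (σ - 1) * f t)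
    (fun i => mul_nonneg hΓ.le (div_nonneg (hf.nonneg i) (by have := hp' i; positivity)))
    fun s => ?_
  simp only [← hval]
  rw [← integral_finsetSum s fun i _ => hint i]
  refine setIntegral_mono_on (integrable_finsetSum s fun i _ => hint i) hI measurableSet_Ioi
    fun t h0 => ?_
  have h0 : 0 < t := h0
  rw [← Finset.mul_sum]
  refine mul_le_mul_of_nonneg_left ?_ (by positivity)
  exact sum_le_hasSum s (fun i _ => mul_nonneg (hf.nonneg i) (Real.exp_pos _).le) (hf.hasSum t h0)

end IsExpSeries

namespace IsExpSeries

theorem one_of_unique {ι : Type*} [Unique ι] {c : ι → ℝ} {p : ι → ℕ} (hc : c default = 1)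
    (hp : p default = 0) : IsExpSeries c p (fun _ => 1) where
  nonneg i := by rw [Unique.eq_default i, hc]; exact zero_le_one
  hasSum t _ := by simpa [hc, hp] using hasSum_unique (fun i => c i * Real.exp (-p i * t))

/-- Multiplication by the kernel appends a summation variable. -/
theorem boseKernel_mul_snoc {n : ℕ} {c : (Fin n → ℕ+) → ℝ} {p : (Fin n → ℕ+) → ℕ} {f : ℝ → ℝ}
    (h : IsExpSeries c p f) {d : (Fin (n + 1) → ℕ+) → ℝ} {q : (Fin (n + 1) → ℕ+) → ℕ}
    (hd : ∀ m x, d (Fin.snoc m x) = c m) (hq : ∀ m x, q (Fin.snoc m x) = p m + (x : ℕ)) :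
    IsExpSeries d q (fun t => _root_.boseKernel t * f t) := by
  refine (IsExpSeries.boseKernel.mul h).reindex (Fin.snocEquiv fun _ => ℕ+) ?_ ?_
  · rintro ⟨x, m⟩
    simpa [Fin.snocEquiv] using hd m x
  · rintro ⟨x, m⟩
    simpa [Fin.snocEquiv, add_comm] using hq m x

end IsExpSeries

/-! ### Multiple polylogarithms at e^(-t) as exponential series. -/

theorem sum_filter_le_castSucc {n : ℕ} (k : Fin n) (m : Fin n → ℕ+) (x : ℕ+) :
    ∑ j ∈ Finset.univ.filter (fun j : Fin (n + 1) => j ≤ k.castSucc),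
        ((Fin.snoc m x : Fin (n + 1) → ℕ+) j : ℕ) =
      ∑ j ∈ Finset.univ.filter (fun j => j ≤ k), (m j : ℕ) := by
  simp [Finset.sum_filter, Fin.sum_univ_castSucc, not_le.2 (Fin.castSucc_lt_last k)]

theorem sum_filter_lt_castSucc {n : ℕ} (k : Fin n) (m : Fin n → ℕ+) (x : ℕ+) :
    ∑ j ∈ Finset.univ.filter (fun j : Fin (n + 1) => j < k.castSucc),
        ((Fin.snoc m x : Fin (n + 1) → ℕ+) j : ℕ) =
      ∑ j ∈ Finset.univ.filter (fun j => j < k), (m j : ℕ) := by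
  simp [Finset.sum_filter, Fin.sum_univ_castSucc, not_lt.2 (Fin.castSucc_lt_last k).le]

/-- The coefficient `∏_k (∑_{j ≤ k} m_j) ^ (-σ_k)`. -/
noncomputable def blockCoeff {n : ℕ} (σ : Fin n → ℕ) (m : Fin n → ℕ+) : ℝ :=
  ∏ k, 1 / ((∑ j ∈ Finset.univ.filter (fun j => j ≤ k), (m j : ℕ) : ℕ) : ℝ) ^ σ k

theorem blockCoeff_snoc {n : ℕ} (σ : Fin (n + 1) → ℕ) (m : Fin n → ℕ+) (x : ℕ+) :
    blockCoeff σ (Fin.snoc m x : Fin (n + 1) → ℕ+) =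
      blockCoeff (fun k => σ k.castSucc) m *
        (1 / ((∑ j, ((Fin.snoc m x : Fin (n + 1) → ℕ+) j : ℕ) : ℕ) : ℝ) ^ σ (Fin.last n)) := by
  rw [blockCoeff, Fin.prod_univ_castSucc, blockCoeff]
  congr 1
  · refine Finset.prod_congr rfl fun k _ => ?_
    rw [sum_filter_le_castSucc]
  · rw [Finset.filter_true_of_mem fun j _ => Fin.le_last j]

theorem one_le_sum_pnat {n : ℕ} (m : Fin (n + 1) → ℕ+) : 1 ≤ ∑ j, (m j : ℕ) :=
  (m 0).pos.trans_le (Finset.single_le_sum (f := fun j => (m j : ℕ)) (fun _ _ => Nat.zero_le _)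
    (Finset.mem_univ 0))

/-- The new variable enters the exponent but not yet the coefficient; tail integrals afterwards
supply the powers of the new total. Without them this is the generating series of an Euler-Zagier
sum whose last exponent is left free. -/
theorem isExpSeries_boseKernel_mul_polyTail {n : ℕ} {σ : Fin n → ℕ}
    (h : IsExpSeries (blockCoeff σ) (fun m => ∑ j, (m j : ℕ))
      (polyTail (fun _ => 1) (List.ofFn σ))) :
    IsExpSeries (fun m : Fin (n + 1) → ℕ+ => blockCoeff σ (Fin.init m)) (fun m => ∑ j, (m j : ℕ))
      (fun t => boseKernel t * polyTail (fun _ => 1) (List.ofFn σ) t) :=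
  h.boseKernel_mul_snoc (fun m x => by rw [Fin.init_snoc]) fun m x => by
    simp [Fin.sum_univ_castSucc]

/-- The multiple polylogarithm `Li_σ(e ^ (-t))` as an iterated tail integral. -/
theorem isExpSeries_polyTail {n : ℕ} (σ : Fin n → ℕ) :
    IsExpSeries (blockCoeff σ) (fun m => ∑ j, (m j : ℕ))
      (polyTail (fun _ => 1) (List.ofFn σ)) := by
  induction n with
  | zero => exact IsExpSeries.one_of_unique (by simp [blockCoeff]) (by simp)
  | succ n ih =>
    have h1 := isExpSeries_boseKernel_mul_polyTail (ih (σ := fun k => σ k.castSucc))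
    rw [List.ofFn_succ', List.concat_eq_append, polyTail_append]
    convert! h1.tailIntegral_iterate one_le_sum_pnat (σ (Fin.last n)) using 1
    funext m
    conv_lhs => rw [← Fin.snoc_init_self m, blockCoeff_snoc, Fin.snoc_init_self]

/-- The last factors of the generalized Mordell-Tornheim series, over a base series. -/
theorem IsExpSeries.boseKernel_mul_polyTail {α : Type*} [Countable α] {c : α → ℝ} {P : α → ℕ}
    {g : ℝ → ℝ} (h : IsExpSeries c P (fun t => _root_.boseKernel t * g t)) (hP : ∀ a, 1 ≤ P a)
    {q : ℕ} (x : Fin q → ℕ) :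
    IsExpSeries (fun a : α × (Fin q → ℕ+) => c a.1 *
        ∏ u, 1 / ((P a.1 + ∑ v ∈ Finset.univ.filter (fun v => v < u), (a.2 v : ℕ) : ℕ) : ℝ) ^ x u)
      (fun a => P a.1 + ∑ v, (a.2 v : ℕ))
      (fun t => _root_.boseKernel t * polyTail g (List.ofFn x) t) := by
  induction q with
  | zero =>
    refine h.reindex (Equiv.prodUnique α (Fin 0 → ℕ+)).symm ?_ ?_ <;> simp
  | succ q ih =>
    have h1 := ih (fun u => x u.castSucc)
    have h2 := h1.tailIntegral_iterate (fun a => (hP a.1).trans (Nat.le_add_right _ _))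
      (x (Fin.last q))
    have h3 := IsExpSeries.boseKernel.mul h2
    rw [List.ofFn_succ', List.concat_eq_append, polyTail_append]
    -- The variable contributed by the kernel comes first in the product series but must be the last
    -- of the m'_v.
    let e : ℕ+ × (α × (Fin q → ℕ+)) ≃ α × (Fin (q + 1) → ℕ+) :=
      (Equiv.prodAssoc _ _ _).symm.trans (((Equiv.prodComm _ _).prodCongr (Equiv.refl _)).trans
        ((Equiv.prodAssoc _ _ _).trans
          ((Equiv.refl _).prodCongr (Fin.snocEquiv fun _ : Fin (q + 1) => ℕ+))))
    have he : ∀ y, e y = (y.2.1, (Fin.snoc y.2.2 y.1 : Fin (q + 1) → ℕ+)) := fun y => rfl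
    refine h3.reindex e ?_ ?_
    · rintro ⟨y, a, m⟩
      simp only [he, one_mul]
      rw [Fin.prod_univ_castSucc, mul_assoc]
      congr 2
      · refine Finset.prod_congr rfl fun k _ => ?_
        rw [sum_filter_lt_castSucc]
      · simp [Finset.sum_filter, Fin.sum_univ_castSucc, Fin.castSucc_lt_last]
    · rintro ⟨y, a, m⟩
      simp only [he, Fin.sum_univ_castSucc, Fin.snoc_castSucc, Fin.snoc_last]
      ring

/-! ### Mordell-Tornheim polylogarithms at 1 - e^(-t). -/

section

variable {r : ℕ}

/-- The denominator `∏ m_i ^ h_i * (∑ m_i) ^ q`. -/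
noncomputable def mtDenom (h : Fin r → ℕ) (q : ℕ) (m : Fin r → ℕ+) : ℝ :=
  (∏ i, ((m i : ℕ) : ℝ) ^ h i) * ((∑ i, (m i : ℕ) : ℕ) : ℝ) ^ q

/-- The multi-polylogarithm of Mordell-Tornheim type at the real point `1 - e ^ (-t)`. -/
noncomputable def mtPolylog (h : Fin r → ℕ) (q : ℕ) (t : ℝ) : ℝ :=
  ∑' m : Fin r → ℕ+, (1 - Real.exp (-t)) ^ (∑ i, (m i : ℕ)) / mtDenom h q m

/-- The Mordell-Tornheim multiple zeta value. -/
noncomputable def mtValue (h : Fin r → ℕ) (q : ℕ) : ℝ :=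
  ∑' m : Fin r → ℕ+, 1 / mtDenom h q m

theorem mtDenom_nonneg (h : Fin r → ℕ) (q : ℕ) (m : Fin r → ℕ+) : 0 ≤ mtDenom h q m := by
  unfold mtDenom
  positivity

theorem one_sub_exp_neg_pos {t : ℝ} (ht : 0 < t) : 0 < 1 - Real.exp (-t) := by
  simpa using ht

theorem one_sub_exp_neg_lt_one (t : ℝ) : 1 - Real.exp (-t) < 1 := by
  simpa using Real.exp_pos (-t)

theorem hasSum_pnat_pow_div {t : ℝ} (ht : 0 < t) :
    HasSum (fun m : ℕ+ => (1 - Real.exp (-t)) ^ (m : ℕ) / (m : ℕ)) t := by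
  have h := Real.hasSum_pow_div_log_of_abs_lt_one (x := 1 - Real.exp (-t))
    (by rw [abs_of_pos (one_sub_exp_neg_pos ht)]; exact one_sub_exp_neg_lt_one t)
  rw [sub_sub_cancel, Real.log_exp, neg_neg, ← Equiv.pnatEquivNat.hasSum_iff] at h
  refine h.congr_fun fun m => ?_
  have hm : (m : ℕ) = Equiv.pnatEquivNat m + 1 := (PNat.natPred_add_one m).symm
  simp only [Function.comp_apply, hm]
  push_cast
  rfl

theorem summable_pnat_pow_div_pow {t : ℝ} (ht : 0 < t) {k : ℕ} (hk : 1 ≤ k) :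
    Summable fun m : ℕ+ => (1 - Real.exp (-t)) ^ (m : ℕ) / ((m : ℕ) : ℝ) ^ k := by
  have hz := one_sub_exp_neg_pos ht
  refine (hasSum_pnat_pow_div ht).summable.of_nonneg_of_le (fun m => by positivity) fun m => ?_
  have hm : (1 : ℝ) ≤ (m : ℕ) := by exact_mod_cast m.pos
  gcongr
  exact le_self_pow₀ hm (by omega)

theorem pow_sum_div_mtDenom_zero (h : Fin r → ℕ) (z : ℝ) (m : Fin r → ℕ+) :
    z ^ (∑ i, (m i : ℕ)) / mtDenom h 0 m = ∏ i, z ^ (m i : ℕ) / ((m i : ℕ) : ℝ) ^ h i := by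
  rw [mtDenom, pow_zero, mul_one, Finset.prod_div_distrib, Finset.prod_pow_eq_pow_sum]

theorem mtPolylog_zero_eq_prod {h : Fin r → ℕ} (hh : ∀ i, 1 ≤ h i) {t : ℝ} (ht : 0 < t) :
    mtPolylog h 0 t =
      ∏ i, ∑' m : ℕ+, (1 - Real.exp (-t)) ^ (m : ℕ) / ((m : ℕ) : ℝ) ^ h i := by
  have hz := one_sub_exp_neg_pos ht
  have h1 := hasSum_pi_prod (fun (i : Fin r) (m : ℕ+) =>
    (1 - Real.exp (-t)) ^ (m : ℕ) / ((m : ℕ) : ℝ) ^ h i) _ (fun i m => by positivity)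
    fun i => (summable_pnat_pow_div_pow ht (hh i)).hasSum
  rw [mtPolylog, ← h1.tsum_eq]
  simp only [pow_sum_div_mtDenom_zero]

theorem hasSum_prod_pow_div {t : ℝ} (ht : 0 < t) :
    HasSum (fun m : Fin r → ℕ+ => ∏ i, (1 - Real.exp (-t)) ^ (m i : ℕ) / (m i : ℕ)) (t ^ r) := by
  have hz := one_sub_exp_neg_pos ht
  simpa using hasSum_pi_prod (fun (_ : Fin r) (m : ℕ+) =>
    (1 - Real.exp (-t)) ^ (m : ℕ) / (m : ℕ)) _ (fun i m => by positivity)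
    fun i => hasSum_pnat_pow_div ht

theorem one_le_sum_pnat_of_pos (hr : 0 < r) (m : Fin r → ℕ+) : 1 ≤ ∑ j, (m j : ℕ) :=
  (m ⟨0, hr⟩).pos.trans_le (Finset.single_le_sum (f := fun j => (m j : ℕ))
    (fun _ _ => Nat.zero_le _) (Finset.mem_univ _))

theorem prod_le_mtDenom (hr : 0 < r) {h : Fin r → ℕ} (hh : ∀ i, 1 ≤ h i) (q : ℕ)
    (m : Fin r → ℕ+) : ∏ i, ((m i : ℕ) : ℝ) ≤ mtDenom h q m := by
  have h1 : ∏ i, ((m i : ℕ) : ℝ) ≤ ∏ i, ((m i : ℕ) : ℝ) ^ h i := by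
    refine Finset.prod_le_prod (fun i _ => by positivity) fun i _ => ?_
    exact le_self_pow₀ (by exact_mod_cast (m i).pos) (by have := hh i; omega)
  refine h1.trans (le_mul_of_one_le_right (by positivity) (one_le_pow₀ ?_))
  exact_mod_cast one_le_sum_pnat_of_pos hr m

theorem mtDenom_pos (hr : 0 < r) {h : Fin r → ℕ} (hh : ∀ i, 1 ≤ h i) (q : ℕ)
    (m : Fin r → ℕ+) : 0 < mtDenom h q m :=
  (Finset.prod_pos fun i _ => by exact_mod_cast (m i).pos).trans_le (prod_le_mtDenom hr hh q m)

theorem mtTerm_le (hr : 0 < r) {h : Fin r → ℕ} (hh : ∀ i, 1 ≤ h i) (q : ℕ) {t : ℝ} (ht : 0 < t)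
    (m : Fin r → ℕ+) : (1 - Real.exp (-t)) ^ (∑ i, (m i : ℕ)) / mtDenom h q m ≤
      ∏ i, (1 - Real.exp (-t)) ^ (m i : ℕ) / (m i : ℕ) := by
  have hz := one_sub_exp_neg_pos ht
  rw [Finset.prod_div_distrib, Finset.prod_pow_eq_pow_sum]
  exact div_le_div_of_nonneg_left (by positivity)
    (Finset.prod_pos fun i _ => by exact_mod_cast (m i).pos) (prod_le_mtDenom hr hh q m)

theorem mtTerm_nonneg (h : Fin r → ℕ) (q : ℕ) {t : ℝ} (ht : 0 < t) (m : Fin r → ℕ+) :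
    0 ≤ (1 - Real.exp (-t)) ^ (∑ i, (m i : ℕ)) / mtDenom h q m :=
  div_nonneg (pow_nonneg (one_sub_exp_neg_pos ht).le _) (mtDenom_nonneg h q m)

theorem summable_mtTerm (hr : 0 < r) {h : Fin r → ℕ} (hh : ∀ i, 1 ≤ h i) (q : ℕ) {t : ℝ}
    (ht : 0 < t) : Summable fun m : Fin r → ℕ+ =>
      (1 - Real.exp (-t)) ^ (∑ i, (m i : ℕ)) / mtDenom h q m :=
  (hasSum_prod_pow_div ht).summable.of_nonneg_of_le (mtTerm_nonneg h q ht) (mtTerm_le hr hh q ht)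

theorem mtPolylog_nonneg (h : Fin r → ℕ) (q : ℕ) {t : ℝ} (ht : 0 < t) : 0 ≤ mtPolylog h q t :=
  tsum_nonneg (mtTerm_nonneg h q ht)

/-- Termwise comparison with Li_1(1 - e^(-t))^r = t^r. This order of vanishing at 0 is what widens
the half-plane of the Ito integral to Re s > 1 - r. -/
theorem mtPolylog_le (hr : 0 < r) {h : Fin r → ℕ} (hh : ∀ i, 1 ≤ h i) (q : ℕ) {t : ℝ}
    (ht : 0 < t) : mtPolylog h q t ≤ t ^ r :=
  hasSum_le (mtTerm_le hr hh q ht) (summable_mtTerm hr hh q ht).hasSum (hasSum_prod_pow_div ht)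

/-- Since S = ∑ m_i is at least each m_i, it is at least ∏ m_i^(1/r). One factor S therefore
dominates the series by a product of r convergent series with exponent 1 + 1/r. -/
theorem summable_one_div_mtDenom (hr : 0 < r) {h : Fin r → ℕ} (hh : ∀ i, 1 ≤ h i) {q : ℕ}
    (hq : 1 ≤ q) : Summable fun m : Fin r → ℕ+ => 1 / mtDenom h q m := by
  have hr' : (0 : ℝ) < r := by exact_mod_cast hr
  have h1 : Summable fun m : ℕ+ => 1 / ((m : ℕ) : ℝ) ^ (1 + 1 / (r : ℝ)) :=
    (Real.summable_one_div_nat_rpow.2 (by simp [hr])).comp_injective PNat.coe_injective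
  have h2 := (hasSum_pi_prod (fun (_ : Fin r) (m : ℕ+) => 1 / ((m : ℕ) : ℝ) ^ (1 + 1 / (r : ℝ)))
    _ (fun i m => by positivity) fun i => h1.hasSum).summable
  refine h2.of_nonneg_of_le (fun m => one_div_nonneg.2 (mtDenom_nonneg h q m)) fun m => ?_
  set S : ℝ := ((∑ i, (m i : ℕ) : ℕ) : ℝ) with hS
  have hm : ∀ i, (0 : ℝ) < (m i : ℕ) := fun i => by exact_mod_cast (m i).pos
  have hS1 : 1 ≤ S := by rw [hS]; exact_mod_cast one_le_sum_pnat_of_pos hr m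
  have h3 : ∏ i, ((m i : ℕ) : ℝ) ^ (1 / (r : ℝ)) ≤ S := by
    calc ∏ i, ((m i : ℕ) : ℝ) ^ (1 / (r : ℝ)) ≤ ∏ _i : Fin r, S ^ (1 / (r : ℝ)) := by
          refine Finset.prod_le_prod (fun i _ => by positivity) fun i _ => ?_
          refine Real.rpow_le_rpow (hm i).le ?_ (by positivity)
          rw [hS]
          exact_mod_cast Finset.single_le_sum (f := fun j => (m j : ℕ))
            (fun _ _ => Nat.zero_le _) (Finset.mem_univ i)
      _ = S := by
          rw [Finset.prod_const, Finset.card_univ, Fintype.card_fin, ← Real.rpow_natCast,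
            ← Real.rpow_mul (by linarith), one_div_mul_cancel hr'.ne', Real.rpow_one]
  rw [Finset.prod_div_distrib, Finset.prod_const_one]
  refine one_div_le_one_div_of_le (Finset.prod_pos fun i _ => Real.rpow_pos_of_pos (hm i) _) ?_
  have h4 : ∀ i, ((m i : ℕ) : ℝ) ^ (1 + 1 / (r : ℝ)) =
      ((m i : ℕ) : ℝ) * ((m i : ℕ) : ℝ) ^ (1 / (r : ℝ)) := fun i => by
    rw [Real.rpow_add (hm i), Real.rpow_one]
  simp only [h4]
  rw [Finset.prod_mul_distrib, mtDenom]
  refine mul_le_mul ?_ (h3.trans (le_self_pow₀ hS1 (by omega)))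
    (Finset.prod_nonneg fun i _ => by positivity) (Finset.prod_nonneg fun i _ => by positivity)
  refine Finset.prod_le_prod (fun i _ => (hm i).le) fun i _ => ?_
  exact le_self_pow₀ (by exact_mod_cast (m i).pos) (by have := hh i; omega)

/-- This is dz/z = du/(e^u - 1) for z = 1 - e^(-u); it makes z^N/N an antiderivative of the kernel
times z^N. -/
theorem boseKernel_mul_one_sub_exp_neg {u : ℝ} (hu : 0 < u) :
    boseKernel u * (1 - Real.exp (-u)) = Real.exp (-u) := by
  have h1 : Real.exp u - 1 ≠ 0 := (sub_pos.2 (Real.one_lt_exp_iff.2 hu)).ne'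
  rw [boseKernel, one_div, inv_mul_eq_iff_eq_mul₀ h1, sub_mul, ← Real.exp_add]
  simp

theorem hasDerivAt_one_sub_exp_neg_pow_div {N : ℕ} (hN : 1 ≤ N) {u : ℝ} (hu : 0 < u) :
    HasDerivAt (fun u => (1 - Real.exp (-u)) ^ N / N)
      (boseKernel u * (1 - Real.exp (-u)) ^ N) u := by
  have h1 : HasDerivAt (fun u => 1 - Real.exp (-u)) (Real.exp (-u)) u := by
    simpa using (hasDerivAt_neg u).exp.const_sub 1
  refine ((h1.pow N).div_const _).congr_deriv ?_
  obtain ⟨N, rfl⟩ := Nat.exists_eq_add_of_le' hN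
  have h2 : ((N + 1 : ℕ) : ℝ) ≠ 0 := by positivity
  rw [pow_succ' (1 - Real.exp (-u)) N, ← mul_assoc, boseKernel_mul_one_sub_exp_neg hu]
  field_simp
  simp

theorem tendsto_one_sub_exp_neg_pow_div (N : ℕ) :
    Tendsto (fun u => (1 - Real.exp (-u)) ^ N / (N : ℝ)) atTop (𝓝 (1 / N)) := by
  have h := ((Real.tendsto_exp_neg_atTop_nhds_zero.const_sub 1).pow N).div_const (N : ℝ)
  simpa using h

theorem integrableOn_boseKernel_mul_pow {N : ℕ} (hN : 1 ≤ N) {t : ℝ} (ht : 0 < t) :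
    IntegrableOn (fun u => boseKernel u * (1 - Real.exp (-u)) ^ N) (Ioi t) :=
  integrableOn_Ioi_deriv_of_nonneg'
    (fun _ hu => hasDerivAt_one_sub_exp_neg_pow_div hN (lt_of_lt_of_le ht hu))
    (fun _ hu => mul_nonneg (boseKernel_pos (ht.trans hu)).le
      (pow_nonneg (one_sub_exp_neg_pos (ht.trans hu)).le _))
    (tendsto_one_sub_exp_neg_pow_div N)

theorem integral_boseKernel_mul_pow {N : ℕ} (hN : 1 ≤ N) {t : ℝ} (ht : 0 < t) :
    ∫ u in Ioi t, boseKernel u * (1 - Real.exp (-u)) ^ N =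
      1 / N - (1 - Real.exp (-t)) ^ N / N :=
  integral_Ioi_of_hasDerivAt_of_tendsto'
    (fun _ hu => hasDerivAt_one_sub_exp_neg_pow_div hN (lt_of_lt_of_le ht hu))
    (integrableOn_boseKernel_mul_pow hN ht) (tendsto_one_sub_exp_neg_pow_div N)

/-- Integrate z^S times the kernel termwise from t to infinity, where z tends to 1. The factor 1/S
so produced raises the exponent q by one, and the limits at infinity add up to the multiple zeta
value. -/
theorem mtPolylog_succ (hr : 0 < r) {h : Fin r → ℕ} (hh : ∀ i, 1 ≤ h i) (q : ℕ) :
    EqOn (mtPolylog h (q + 1)) (fun t => mtValue h (q + 1) - boseTail (mtPolylog h q) t)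
      (Ioi 0) := by
  intro t ht
  have ht : 0 < t := ht
  have hN := one_le_sum_pnat_of_pos hr (r := r)
  have e : ∀ (m : Fin r → ℕ+) (u : ℝ), boseKernel u *
      ((1 - Real.exp (-u)) ^ (∑ i, (m i : ℕ)) / mtDenom h q m) =
      1 / mtDenom h q m * (boseKernel u * (1 - Real.exp (-u)) ^ (∑ i, (m i : ℕ))) :=
    fun m u => by ring
  have hint : ∀ m : Fin r → ℕ+, IntegrableOn (fun u => boseKernel u *
      ((1 - Real.exp (-u)) ^ (∑ i, (m i : ℕ)) / mtDenom h q m)) (Ioi t) := fun m => by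
    simp only [e]
    exact (integrableOn_boseKernel_mul_pow (hN m) ht).const_mul _
  have hval : ∀ m : Fin r → ℕ+, ∫ u in Ioi t, boseKernel u *
      ((1 - Real.exp (-u)) ^ (∑ i, (m i : ℕ)) / mtDenom h q m) =
      1 / mtDenom h (q + 1) m -
        (1 - Real.exp (-t)) ^ (∑ i, (m i : ℕ)) / mtDenom h (q + 1) m := fun m => by
    simp only [e]
    rw [integral_const_mul, integral_boseKernel_mul_pow (hN m) ht]
    have h1 := (mtDenom_pos hr hh q m).ne'
    have h2 : ((∑ i, (m i : ℕ) : ℕ) : ℝ) ≠ 0 := by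
      have := hN m
      positivity
    have h3 : mtDenom h (q + 1) m = mtDenom h q m * ((∑ i, (m i : ℕ) : ℕ) : ℝ) := by
      simp only [mtDenom, pow_succ]
      ring
    rw [h3]
    field_simp
  have hs1 := summable_one_div_mtDenom hr hh (Nat.le_add_left 1 q)
  have hs2 := summable_mtTerm hr hh (q + 1) ht
  have h1 := hasSum_integral_of_summable_integral_norm hint (by
    refine (hs1.sub hs2).congr fun m => ?_
    rw [← hval m]
    refine setIntegral_congr_fun measurableSet_Ioi fun u hu => ?_
    exact (Real.norm_of_nonneg (mul_nonneg (boseKernel_pos (ht.trans hu)).le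
      (mtTerm_nonneg h q (ht.trans hu) m))).symm)
  have h2 := h1.unique ((hs1.hasSum.sub hs2.hasSum).congr_fun fun m => hval m)
  have h3 : boseTail (mtPolylog h q) t = mtValue h (q + 1) - mtPolylog h (q + 1) t := by
    rw [mtValue, mtPolylog, ← h2]
    simp only [boseTail, tailIntegral, mtPolylog, tsum_mul_left]
  simp only [h3]
  ring

/-- The recursion in q carries tameness upward from q = 0. It is used first with r = 1, starting
from t, and then in general, starting from a product of the one-variable functions. -/
theorem isTame_mtPolylog_of_zero (hr : 0 < r) {h : Fin r → ℕ} (hh : ∀ i, 1 ≤ h i)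
    (h0 : IsTame 0 0 (mtPolylog h 0)) (q : ℕ) : IsTame 0 0 (mtPolylog h q) := by
  induction q with
  | zero => exact h0
  | succ q ih =>
    exact ((IsTame.const (mtValue h (q + 1))).sub ih.boseTail).congr (mtPolylog_succ hr hh q).symm

/-- The one-variable polylogarithm `Li_{q + 1}(1 - e ^ (-t))`. -/
noncomputable def polylog (q : ℕ) (t : ℝ) : ℝ := mtPolylog (fun _ : Fin 1 => 1) q t

/-- The zeta value `ζ(q + 1)`. -/
noncomputable def zetaValue (q : ℕ) : ℝ := mtValue (fun _ : Fin 1 => 1) q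

theorem polylog_eq_tsum (q : ℕ) (t : ℝ) :
    polylog q t = ∑' m : ℕ+, (1 - Real.exp (-t)) ^ (m : ℕ) / ((m : ℕ) : ℝ) ^ (q + 1) := by
  rw [polylog, mtPolylog, ← (Equiv.funUnique (Fin 1) ℕ+).tsum_eq]
  refine tsum_congr fun m => ?_
  simp [mtDenom, pow_succ', Equiv.funUnique]

theorem zetaValue_eq_tsum (q : ℕ) : zetaValue q = ∑' m : ℕ+, 1 / ((m : ℕ) : ℝ) ^ (q + 1) := by
  rw [zetaValue, mtValue, ← (Equiv.funUnique (Fin 1) ℕ+).tsum_eq]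
  refine tsum_congr fun m => ?_
  simp [mtDenom, pow_succ', Equiv.funUnique]

theorem polylog_zero : EqOn (polylog 0) (fun t => t) (Ioi 0) := fun t ht => by
  rw [polylog_eq_tsum]
  simpa using (hasSum_pnat_pow_div ht).tsum_eq

theorem isTame_polylog (q : ℕ) : IsTame 0 0 (polylog q) :=
  isTame_mtPolylog_of_zero one_pos (fun _ => le_rfl)
    (((IsTame.pow 1).congr fun t _ => pow_one t).congr polylog_zero.symm) q

theorem mtPolylog_zero {h : Fin r → ℕ} (hh : ∀ i, 1 ≤ h i) :
    EqOn (mtPolylog h 0) (fun t => ∏ i, polylog (h i - 1) t) (Ioi 0) := fun t ht => by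
  rw [mtPolylog_zero_eq_prod hh ht]
  refine Finset.prod_congr rfl fun i _ => ?_
  rw [polylog_eq_tsum, Nat.sub_add_cancel (hh i)]

theorem isTame_mtPolylog (hr : 0 < r) {h : Fin r → ℕ} (hh : ∀ i, 1 ≤ h i) (q : ℕ) :
    IsTame 0 0 (mtPolylog h q) :=
  isTame_mtPolylog_of_zero hr hh ((IsTame.prod _ fun i _ => isTame_polylog (h i - 1)).congr
    (mtPolylog_zero hh).symm) q

end

/-! ### From polylogarithms at 1 - e^(-t) to polylogarithms at e^(-t). -/

/-- The function `Li_L(e ^ (-t))`. -/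
noncomputable abbrev listPolylog (L : List ℕ) : ℝ → ℝ := polyTail (fun _ => 1) L

theorem isTame_listPolylog {L : List ℕ} (hL : ∀ x ∈ L, 1 ≤ x) : IsTame 0 0 (listPolylog L) :=
  (IsTame.const 1).polyTail hL

theorem isTame_listPolylog_ones (i : ℕ) : IsTame 0 0 (listPolylog (List.replicate i 1)) :=
  isTame_listPolylog fun _ hx => (List.eq_of_mem_replicate hx).ge

theorem boseTail_listPolylog (L : List ℕ) :
    boseTail (listPolylog L) = listPolylog (L ++ [1]) := (polyTail_append_one _ _).symm

/-- Unroll `mtPolylog_succ`. The constant created with weight q - i passes through i further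
operators, and i operators turn 1 into Li_{1,...,1}(e^(-t)) with i ones. -/
theorem mtPolylog_eq {r : ℕ} (hr : 0 < r) {h : Fin r → ℕ} (hh : ∀ i, 1 ≤ h i) (q : ℕ) :
    EqOn (mtPolylog h q) (fun t =>
      ∑ i ∈ Finset.range q, (-1) ^ i * mtValue h (q - i) * listPolylog (List.replicate i 1) t +
        (-1) ^ q * boseTail^[q] (mtPolylog h 0) t) (Ioi 0) := by
  induction q with
  | zero => intro t _; simp
  | succ q ih =>
    intro t ht
    have h0 := isTame_mtPolylog hr hh 0
    simp only [mtPolylog_succ hr hh q ht]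
    rw [boseTail_congr ih ht, boseTail_add (IsTame.sum _ fun i _ =>
      (isTame_listPolylog_ones i).const_mul _) ((h0.boseTail_iterate q).const_mul _) ht]
    beta_reduce
    rw [boseTail_sum _ _ (fun i _ => isTame_listPolylog_ones i) ht]
    simp only [boseTail_const_mul, Finset.sum_range_succ', ← Function.iterate_succ_apply' boseTail,
      boseTail_listPolylog, ← List.replicate_succ', Nat.add_sub_add_right]
    simp only [pow_succ, List.replicate_zero, polyTail_nil, pow_zero, Nat.sub_zero,
      mul_neg_one, neg_mul, Finset.sum_neg_distrib]
    ring

/-- The list `({1}^i, 2, {1}^j)`. -/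
def onesTwoOnes (i j : ℕ) : List ℕ := List.replicate i 1 ++ 2 :: List.replicate j 1

theorem one_le_of_mem_onesTwoOnes {i j x : ℕ} (hx : x ∈ onesTwoOnes i j) : 1 ≤ x := by
  simp only [onesTwoOnes, List.mem_append, List.mem_replicate, List.mem_cons] at hx
  omega

/-- By parts, `boseTail` of t g is t times `boseTail` of g plus one more tail integral of the
latter. That extra integral turns the newly appended entry 1 into a 2; later operators append ones
after it. -/
theorem boseTail_iterate_id (q : ℕ) :
    EqOn (boseTail^[q] fun t => t) (fun t => t * listPolylog (List.replicate q 1) t +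
      ∑ i ∈ Finset.range q, listPolylog (onesTwoOnes i (q - 1 - i)) t) (Ioi 0) := by
  induction q with
  | zero => intro t _; simp
  | succ q ih =>
    intro t ht
    have h1 := isTame_listPolylog_ones q
    have h2 : ∀ i j, IsTame 0 0 (listPolylog (onesTwoOnes i j)) := fun i j =>
      isTame_listPolylog fun x => one_le_of_mem_onesTwoOnes
    have h3 : IsTame 0 0 fun t => t * listPolylog (List.replicate q 1) t :=
      (((IsTame.pow 1).mul h1).mono (by simp) (by simp)).congr fun t _ => by simp
    have h4 : boseTail (fun t => t * listPolylog (List.replicate q 1) t) t =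
        t * listPolylog (List.replicate (q + 1) 1) t + listPolylog (onesTwoOnes q 0) t := by
      have h5 := tailIntegral_dividedPower_succ_mul h1.boseKernel_mul 0 ht
      have h6 : EqOn (fun t => boseKernel t * (t * listPolylog (List.replicate q 1) t))
          (fun t => dividedPower (0 + 1) t * (boseKernel t * listPolylog (List.replicate q 1) t))
          (Ioi 0) := fun t _ => by
        simp only [dividedPower]
        simp
        ring
      rw [boseTail, tailIntegral_congr h6 ht, h5]
      beta_reduce
      rw [List.replicate_succ', onesTwoOnes]
      simp only [listPolylog, polyTail_append]
      simp [dividedPower]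
    rw [Function.iterate_succ_apply', boseTail_congr ih ht,
      boseTail_add h3 (IsTame.sum _ fun i _ => h2 i _) ht]
    beta_reduce
    rw [h4, Finset.sum_range_succ]
    have h7 := boseTail_sum (Finset.range q) (fun _ => 1) (fun i _ => h2 i (q - 1 - i)) ht
    simp only [one_mul] at h7
    rw [h7, add_assoc, add_comm (listPolylog (onesTwoOnes q 0) t)]
    congr 2
    · refine Finset.sum_congr rfl fun i hi => ?_
      have hi := Finset.mem_range.1 hi
      rw [boseTail_listPolylog, onesTwoOnes, List.append_assoc, List.cons_append,
        ← List.replicate_succ', onesTwoOnes, show q - 1 - i + 1 = q + 1 - 1 - i by omega]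
    · simp

/-- The tuple `𝐤(j,k)` of natural numbers. -/
def kList (j k : ℕ) : List ℕ :=
  if j < k then List.replicate j 1 else onesTwoOnes (j - k) (2 * k - 2 - j)

theorem one_le_of_mem_kList {j k x : ℕ} (hx : x ∈ kList j k) : 1 ≤ x := by
  unfold kList at hx
  split_ifs at hx
  · exact (List.eq_of_mem_replicate hx).ge
  · exact one_le_of_mem_onesTwoOnes hx

/-- The coefficient `a(j,k)` as a real number. -/
noncomputable def aReal (j k : ℕ) : ℝ :=
  if j < k - 1 then (-1) ^ j * zetaValue (k - 1 - j) else (-1) ^ (k - 1)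

/-- The three ranges of j are the three sources of terms: j < k - 1 the constants ζ(k-j) in
`mtPolylog_eq`, j = k - 1 the term with the factor t, and j > k - 1 the terms with an entry 2 in
`boseTail_iterate_id`. -/
theorem polylog_eq_sum {k : ℕ} (hk : 1 ≤ k) :
    EqOn (polylog (k - 1)) (fun t => ∑ j ∈ Finset.Icc 0 (2 * k - 2),
      aReal j k * ((if j = k - 1 then t else 1) * listPolylog (kList j k) t)) (Ioi 0) := by
  obtain ⟨q, rfl⟩ := Nat.exists_eq_add_of_le' hk
  intro t ht
  have e : Finset.Icc 0 (2 * (q + 1) - 2) = Finset.range (q + 1 + q) := by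
    ext x
    simp only [Finset.mem_Icc, Finset.mem_range]
    omega
  simp only [e]
  have h0 : boseTail^[q] (mtPolylog (fun _ : Fin 1 => 1) 0) t = _ :=
    (boseTail_iterate_congr polylog_zero q).trans (boseTail_iterate_id q) ht
  rw [Nat.add_sub_cancel, polylog, mtPolylog_eq one_pos (fun _ => le_rfl) q ht]
  beta_reduce
  rw [h0, Finset.sum_range_add, Finset.sum_range_succ, add_assoc, mul_add, Finset.mul_sum]
  congr 1
  · refine Finset.sum_congr rfl fun j hj => ?_
    have hj := Finset.mem_range.1 hj
    simp [aReal, kList, hj, hj.ne, show j < q + 1 by omega, zetaValue]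
  · congr 1
    · simp [aReal, kList]
    · refine Finset.sum_congr rfl fun j hj => ?_
      have hj := Finset.mem_range.1 hj
      have h1 : ¬ q + 1 + j < q := by omega
      have h2 : ¬ q + 1 + j = q := by omega
      have h3 : ¬ q + 1 + j ≤ q := by omega
      simp [aReal, kList, h1, h2, h3, show 2 * (q + 1) - 2 - (q + 1 + j) = q - 1 - j by omega]

/-- The product of the polylogarithms `Li_{𝐤(j_i,k_i)}(e ^ (-t))`. -/
noncomputable def kListProd {n : ℕ} (j k : Fin n → ℕ) (t : ℝ) : ℝ :=
  ∏ i, listPolylog (kList (j i) (k i)) t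

theorem isTame_kListProd {n : ℕ} (j k : Fin n → ℕ) : IsTame 0 0 (kListProd j k) :=
  IsTame.prod _ fun _ _ => isTame_listPolylog fun _ => one_le_of_mem_kList

theorem one_le_onesAppend {n : ℕ} (l : ℕ) {k : Fin n → ℕ} (hk : ∀ i, 2 ≤ k i) (i : Fin (l + n)) :
    1 ≤ onesAppend l k i := by
  refine Fin.addCases (fun i => ?_) (fun i => ?_) i
  · simp [onesAppend]
  · simpa [onesAppend] using (hk i).trans' one_le_two

/-- Multiply out the product over i. The l leading ones and each i with j_i = k_i - 1 give one
factor t; rewriting the power as a divided power brings in the factorial. -/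
theorem mtPolylog_onesAppend_zero {n : ℕ} (l : ℕ) {k : Fin n → ℕ} (hk : ∀ i, 2 ≤ k i) :
    EqOn (mtPolylog (onesAppend l k) 0) (fun t =>
      ∑ j ∈ Fintype.piFinset (fun i => Finset.Icc 0 (2 * k i - 2)),
        ((l + bCount j k).factorial * ∏ i, aReal (j i) (k i)) *
          (dividedPower (l + bCount j k) t * kListProd j k t)) (Ioi 0) := by
  intro t ht
  have hh := one_le_onesAppend l hk
  rw [mtPolylog_zero hh ht]
  beta_reduce
  rw [Fin.prod_univ_add]
  simp only [onesAppend, Fin.append_left, Fin.append_right, Nat.sub_self, polylog_zero ht,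
    Finset.prod_const, Finset.card_univ, Fintype.card_fin]
  rw [Finset.prod_congr rfl fun i _ => polylog_eq_sum ((hk i).trans' one_le_two) ht,
    Finset.prod_univ_sum, Finset.mul_sum]
  refine Finset.sum_congr rfl fun j _ => ?_
  have hf : ((l + bCount j k).factorial : ℝ) ≠ 0 := by positivity
  rw [Finset.prod_mul_distrib, Finset.prod_mul_distrib, Finset.prod_ite, Finset.prod_const_one,
    Finset.prod_const, dividedPower, kListProd, pow_add]
  simp only [bCount] at hf ⊢
  field_simp

theorem neg_one_pow_mul_mtPolylog_onesAppend {n : ℕ} (hn : 1 ≤ n) (l : ℕ) {k : Fin n → ℕ}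
    (hk : ∀ i, 2 ≤ k i) (q : ℕ) :
    EqOn (fun t => (-1) ^ q * mtPolylog (onesAppend l k) q t) (fun t =>
      (∑ j ∈ Fintype.piFinset (fun i => Finset.Icc 0 (2 * k i - 2)),
        ∑ c ∈ Finset.Nat.antidiagonalTuple (q + 1) (l + bCount j k),
          ((l + bCount j k).factorial * ∏ i, aReal (j i) (k i)) *
            (dividedPower (c (Fin.last q)) t * polyTail (kListProd j k)
              (List.ofFn fun u : Fin q => c u.castSucc + 1) t)) -
      ∑ i ∈ Finset.Icc 1 q, (-1) ^ (i - 1) * mtValue (onesAppend l k) i *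
        listPolylog (List.replicate (q - i) 1) t) (Ioi 0) := by
  intro t ht
  have hh := one_le_onesAppend l hk
  beta_reduce
  rw [mtPolylog_eq (by omega) hh q ht]
  beta_reduce
  rw [mul_add, ← mul_assoc, ← pow_add, ← two_mul,
    pow_mul, neg_one_sq, one_pow, one_mul,
    boseTail_iterate_congr (mtPolylog_onesAppend_zero l hk) q ht,
    boseTail_iterate_sum _ _ (fun j _ => ((IsTame.dividedPower _).mul
      (isTame_kListProd j k)).mono (by simp) (by simp)) q ht, add_comm, sub_eq_add_neg]
  congr 1
  · refine Finset.sum_congr rfl fun j _ => ?_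
    rw [boseTail_iterate_dividedPower_mul q _ (isTame_kListProd j k) ht, Finset.mul_sum]
  · rw [Finset.mul_sum, ← Finset.sum_neg_distrib]
    -- The theorem indexes by the weight of the zeta value, which is q - i here.
    refine Finset.sum_bij' (fun i _ => q - i) (fun i _ => q - i) ?_ ?_ ?_ ?_ ?_
    · intro i hi
      simp only [Finset.mem_range, Finset.mem_Icc] at hi ⊢
      omega
    · intro i hi
      simp only [Finset.mem_range, Finset.mem_Icc] at hi ⊢
      omega
    · intro i hi
      simp only [Finset.mem_range] at hi
      omega
    · intro i hi
      simp only [Finset.mem_Icc] at hi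
      omega
    · intro i hi
      have hi := Finset.mem_range.1 hi
      rw [Nat.sub_sub_self hi.le]
      have h1 : (-1 : ℝ) ^ q * (-1) ^ i = -(-1) ^ (q - i - 1) := by
        rw [← pow_add, show q + i = q - i - 1 + (2 * i + 1) by omega, pow_add, pow_succ, pow_mul]
        simp
      rw [← mul_assoc, ← mul_assoc, h1]
      ring

/-! ### Identity theorem and gluing of meromorphic continuations. -/

/-- Two meromorphic functions on a preconnected set that agree near one point agree near every
point, apart from the point itself. -/
theorem MeromorphicOn.eventuallyEq_of_isPreconnected {f g : ℂ → ℂ} {U : Set ℂ}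
    (hf : MeromorphicOn f U) (hg : MeromorphicOn g U) (hU : IsPreconnected U) {x y : ℂ}
    (hx : x ∈ U) (hy : y ∈ U) (h : f =ᶠ[𝓝[≠] x] g) : f =ᶠ[𝓝[≠] y] g := by
  have h1 : meromorphicOrderAt (f - g) x = ⊤ := by
    rw [meromorphicOrderAt_eq_top_iff]
    filter_upwards [h] with z hz
    simp [hz]
  have h2 : meromorphicOrderAt (f - g) y = ⊤ := by
    by_contra h2
    exact (hf.sub hg).meromorphicOrderAt_ne_top_of_isPreconnected hU hy hx h2 h1
  rw [meromorphicOrderAt_eq_top_iff] at h2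
  filter_upwards [h2] with z hz
  exact sub_eq_zero.1 hz

theorem isOpen_re_gt (c : ℝ) : IsOpen {s : ℂ | c < s.re} :=
  isOpen_lt continuous_const Complex.continuous_re

theorem isPreconnected_re_gt (c : ℝ) : IsPreconnected {s : ℂ | c < s.re} :=
  (convex_halfSpace_re_gt c).isPreconnected

theorem MeromorphicOn.eventuallyEq_of_halfPlane {f g : ℂ → ℂ} {c A : ℝ}
    (hf : MeromorphicOn f {s | c < s.re}) (hg : MeromorphicOn g {s | c < s.re})
    (h : ∀ s : ℂ, A < s.re → f s = g s) {s : ℂ} (hs : c < s.re) : f =ᶠ[𝓝[≠] s] g := by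
  have hx : c < ((max A c + 1 : ℝ) : ℂ).re := by
    rw [Complex.ofReal_re]
    linarith [le_max_right A c]
  refine hf.eventuallyEq_of_isPreconnected hg (isPreconnected_re_gt c) hx hs ?_
  have : {s : ℂ | A < s.re} ∈ 𝓝 (((max A c + 1 : ℝ) : ℂ)) :=
    (isOpen_re_gt A).mem_nhds (show A < ((max A c + 1 : ℝ) : ℂ).re by
      rw [Complex.ofReal_re]
      linarith [le_max_left A c])
  filter_upwards [mem_nhdsWithin_of_mem_nhds this] with z hz using h z hz

/-- A function with a meromorphic continuation to every half-plane `re s > -M` has a meromorphic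
continuation to the plane. -/
theorem exists_meromorphic_of_halfPlanes {f : ℂ → ℂ}
    (h : ∀ M : ℕ, ∃ F : ℂ → ℂ, MeromorphicOn F {s | -(M : ℝ) < s.re} ∧
      ∃ A : ℝ, ∀ s : ℂ, A < s.re → F s = f s) :
    ∃ F : ℂ → ℂ, MeromorphicOn F univ ∧ ∃ A : ℝ, ∀ s : ℂ, A < s.re → F s = f s := by
  choose F hF A hA using h
  -- Chosen so that s lies in its half-plane with distance at least 1 to spare, while the index
  -- grows by at most 1 within distance 1. Near s only finitely many continuations are then used,
  -- all agreeing with number idx s + 1; for Re s > 0 the index is constantly 1.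
  let idx : ℂ → ℕ := fun s => ⌈-s.re⌉₊ + 1
  have hidx : ∀ s, 1 - (idx s : ℝ) ≤ s.re := fun s => by
    have := Nat.le_ceil (-s.re)
    simp only [idx]
    push_cast
    linarith
  refine ⟨fun s => F (idx s) s, fun s _ => ?_, max (A 1) 0, fun s hs => ?_⟩
  · have hcongr : ∀ M ∈ Finset.range (idx s + 2), -(M : ℝ) < s.re →
        F M =ᶠ[𝓝[≠] s] F (idx s + 1) := fun M hM hs => by
      have hM : M ≤ idx s + 1 := Nat.lt_succ_iff.1 (Finset.mem_range.1 hM)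
      have hM' : (M : ℝ) ≤ (idx s + 1 : ℕ) := by exact_mod_cast hM
      refine MeromorphicOn.eventuallyEq_of_halfPlane (A := max (A M) (A (idx s + 1))) (hF M)
        ((hF (idx s + 1)).mono_set fun z hz => lt_of_le_of_lt (neg_le_neg hM') hz)
        (fun z hz => ?_) hs
      rw [hA M z ((le_max_left _ _).trans_lt hz), hA _ z ((le_max_right _ _).trans_lt hz)]
    have hev : ∀ᶠ z in 𝓝[≠] s, ∀ M ∈ Finset.range (idx s + 2), -(M : ℝ) < s.re →
        F M z = F (idx s + 1) z := by
      rw [Finset.eventually_all]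
      intro M hM
      by_cases hs : -(M : ℝ) < s.re
      · filter_upwards [hcongr M hM hs] with z hz _ using hz
      · exact Eventually.of_forall fun z h => absurd h hs
    have hball : ∀ᶠ z in 𝓝[≠] s, |z.re - s.re| < 1 := by
      refine mem_nhdsWithin_of_mem_nhds ?_
      filter_upwards [Metric.ball_mem_nhds s one_pos] with z hz
      rw [Metric.mem_ball, Complex.dist_eq] at hz
      exact (Complex.abs_re_le_norm (z - s)).trans_lt hz
    have hs' : -((idx s + 1 : ℕ) : ℝ) < s.re := by
      have := hidx s
      push_cast
      linarith
    refine (hF (idx s + 1) s hs').congr ?_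
    filter_upwards [hev, hball] with z hz hz1
    rw [abs_lt] at hz1
    refine (hz (idx z) ?_ ?_).symm
    · rw [Finset.mem_range]
      have h1 : ⌈-z.re⌉₊ ≤ ⌈-s.re⌉₊ + 1 := by
        rw [Nat.ceil_le]
        push_cast
        linarith [Nat.le_ceil (-s.re)]
      simp only [idx]
      omega
    · linarith [hidx z]
  · have h1 : idx s = 1 := by
      simp only [idx, Nat.add_eq_right, Nat.ceil_eq_zero]
      linarith [le_max_right (A 1) 0]
    simp only [h1]
    exact hA 1 s ((le_max_left _ _).trans_lt hs)

/-- The normal form of a meromorphic function is the meromorphic continuation of an analytic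
function on a half-plane with which it agrees there. -/
theorem isMeromorphicContinuation_toMeromorphicNFOn {f F : ℂ → ℂ} {σ : ℝ}
    (hF : MeromorphicOn F univ) (hf : ∀ s : ℂ, σ < s.re → AnalyticAt ℂ f s)
    (h : ∀ s : ℂ, σ < s.re → F =ᶠ[𝓝[≠] s] f) :
    IsMeromorphicContinuation f σ (toMeromorphicNFOn F univ) := by
  have h1 : ∀ s : ℂ, σ < s.re → toMeromorphicNFOn F univ =ᶠ[𝓝 s] f := fun s hs =>
    (MeromorphicNFAt.eventuallyEq_nhdsNE_iff_eventuallyEq_nhds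
      (meromorphicNFOn_toMeromorphicNFOn F univ (mem_univ s)) (hf s hs).meromorphicNFAt).1
      ((hF.toMeromorphicNFOn_eq_self_on_nhdsNE (mem_univ s)).trans (h s hs))
  exact ⟨meromorphicNFOn_toMeromorphicNFOn F univ,
    fun s hs => (hf s hs).congr (h1 s hs).symm, fun s hs => (h1 s hs).eq_of_nhds⟩

/-! ### Mellin transforms of tame functions. -/

/-- The restriction of `f` to `(0, 1]`, extended by zero, as a complex function. -/
noncomputable def restrictUnit (f : ℝ → ℝ) (t : ℝ) : ℂ := (indicator (Ioc 0 1) f t : ℝ)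

theorem locallyIntegrableOn_ofReal {f : ℝ → ℝ} (hf : ContinuousOn f (Ioi 0)) :
    LocallyIntegrableOn (fun t => (f t : ℂ)) (Ioi 0) :=
  (Complex.continuous_ofReal.comp_continuousOn hf).locallyIntegrableOn measurableSet_Ioi

theorem locallyIntegrableOn_restrictUnit {f : ℝ → ℝ} (hf : ContinuousOn f (Ioi 0)) :
    LocallyIntegrableOn (restrictUnit f) (Ioi 0) := by
  refine (hf.locallyIntegrableOn measurableSet_Ioi).mono ?_ ?_
  · exact Complex.continuous_ofReal.comp_aestronglyMeasurable
      ((aestronglyMeasurable_indicator_iff measurableSet_Ioc).2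
        ((hf.mono fun t ht => ht.1).aestronglyMeasurable measurableSet_Ioc))
  · refine Eventually.of_forall fun t => ?_
    rw [restrictUnit, Complex.norm_real]
    exact norm_indicator_le_norm_self f t

theorem restrictUnit_eventuallyEq_top (f : ℝ → ℝ) : restrictUnit f =ᶠ[atTop] fun _ => 0 := by
  filter_upwards [Ioi_mem_atTop 1] with t ht
  have h : t ∉ Ioc (0 : ℝ) 1 := fun h => absurd h.2 (not_le.2 ht)
  simp [restrictUnit, indicator_of_notMem h]

theorem isBigO_restrictUnit_top (f : ℝ → ℝ) (a : ℝ) :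
    restrictUnit f =O[atTop] fun t : ℝ => t ^ a :=
  (isBigO_zero _ _).congr' (restrictUnit_eventuallyEq_top f).symm EventuallyEq.rfl

theorem restrictUnit_eventuallyEq_zero (f : ℝ → ℝ) :
    restrictUnit f =ᶠ[𝓝[>] 0] fun t => (f t : ℂ) := by
  filter_upwards [Ioo_mem_nhdsGT (zero_lt_one' ℝ)] with t ht
  have h : t ∈ Ioc (0 : ℝ) 1 := ⟨ht.1, ht.2.le⟩
  rw [restrictUnit, indicator_of_mem h]

theorem restrictUnit_logMonomial_succ (a : ℤ) (b : ℕ) :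
    restrictUnit (logMonomial (a, b + 1)) =
      fun t => Real.log t • restrictUnit (logMonomial (a, b)) t := by
  funext t
  by_cases ht : t ∈ Ioc (0 : ℝ) 1
  · simp only [restrictUnit, indicator_of_mem ht, logMonomial_of_pos _ ht.1, Complex.real_smul]
    push_cast
    ring
  · simp [restrictUnit, indicator_of_notMem ht]

theorem isBigO_restrictUnit_logMonomial (a : ℤ) (b : ℕ) {c : ℝ} (hc : -(a : ℝ) < c) :
    restrictUnit (logMonomial (a, b)) =O[𝓝[>] 0] fun t : ℝ => t ^ (-c) := by
  induction b generalizing c with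
  | zero =>
    refine IsBigO.trans ?_ (isBigO_rpow_zero_of_le (b := a) (by linarith))
    refine (IsBigO.of_bound 1 ?_)
    filter_upwards [self_mem_nhdsWithin, restrictUnit_eventuallyEq_zero (logMonomial (a, 0))]
      with t ht h
    rw [h, logMonomial_of_pos _ ht]
    simp [Real.rpow_intCast]
  | succ b ih =>
    rw [restrictUnit_logMonomial_succ]
    exact isBigO_rpow_zero_log_smul (a := (c - a) / 2) (by linarith) (ih (by linarith))

/-- On (0,1] the Mellin transform of t^a is 1/(s+a), and each factor log t differentiates it in s.
Cutting off at 1 is what makes these transforms converge in a half-plane. -/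
theorem exists_meromorphic_mellin_logMonomial (a : ℤ) (b : ℕ) :
    ∃ R : ℂ → ℂ, MeromorphicOn R univ ∧ ∀ s : ℂ, -(a : ℝ) < s.re →
      MellinConvergent (restrictUnit (logMonomial (a, b))) s ∧
        mellin (restrictUnit (logMonomial (a, b))) s = R s := by
  induction b with
  | zero =>
    refine ⟨fun s => 1 / (s + a), fun s _ => by fun_prop, fun s hs => ?_⟩
    have h := hasMellin_cpow_Ioc (a : ℂ) (s := s) (by simp; linarith)
    have e : restrictUnit (logMonomial (a, 0)) = 
        indicator (Ioc 0 1) fun t : ℝ => (t : ℂ) ^ (a : ℂ) := by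
      funext t
      by_cases ht : t ∈ Ioc (0 : ℝ) 1
      · simp [restrictUnit, indicator_of_mem ht, logMonomial_of_pos _ ht.1]
      · simp [restrictUnit, indicator_of_notMem ht]
    rw [e]
    exact h
  | succ b ih =>
    obtain ⟨R, hR, h⟩ := ih
    refine ⟨deriv R, fun s hs => (hR s hs).deriv, fun s hs => ?_⟩
    have h1 := mellin_hasDerivAt_of_isBigO_rpow (a := s.re + 1) (b := (s.re - a) / 2)
      (locallyIntegrableOn_restrictUnit (continuousOn_of_mem_logPoly (logMonomial_mem (a, b))))
      (isBigO_restrictUnit_top _ _) (by linarith)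
      (isBigO_restrictUnit_logMonomial a b (by linarith)) (by linarith)
    rw [restrictUnit_logMonomial_succ]
    refine ⟨h1.1, ?_⟩
    rw [← h1.2.deriv]
    refine EventuallyEq.deriv_eq ?_
    filter_upwards [(isOpen_re_gt (-(a : ℝ))).mem_nhds hs] with z hz using (h z hz).2

theorem exists_meromorphic_mellin_of_mem_logPoly {P : ℝ → ℝ} (hP : P ∈ logPoly) :
    ∃ R : ℂ → ℂ, MeromorphicOn R univ ∧ ∃ A : ℝ, ∀ s : ℂ, A < s.re →
      MellinConvergent (restrictUnit P) s ∧ mellin (restrictUnit P) s = R s := by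
  induction hP using Submodule.span_induction with
  | mem x hx =>
    obtain ⟨p, rfl⟩ := hx
    obtain ⟨R, hR, h⟩ := exists_meromorphic_mellin_logMonomial p.1 p.2
    exact ⟨R, hR, _, h⟩
  | zero =>
    refine ⟨fun _ => 0, fun s _ => by fun_prop, 0, fun s _ => ?_⟩
    have e : restrictUnit 0 = fun _ => (0 : ℂ) := by
      funext t
      simp [restrictUnit]
    rw [e]
    exact ⟨by simp [MellinConvergent], by simp [mellin]⟩
  | add x y _ _ hx hy =>
    obtain ⟨R, hR, A, h⟩ := hx
    obtain ⟨R', hR', A', h'⟩ := hy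
    refine ⟨R + R', fun s hs => (hR s hs).add (hR' s hs), max A A', fun s hs => ?_⟩
    obtain ⟨c1, e1⟩ := h s ((le_max_left _ _).trans_lt hs)
    obtain ⟨c2, e2⟩ := h' s ((le_max_right _ _).trans_lt hs)
    have h3 := hasMellin_add c1 c2
    have e : restrictUnit (x + y) = fun t => restrictUnit x t + restrictUnit y t := by
      funext t
      simp [restrictUnit, indicator_add']
    rw [e]
    exact ⟨h3.1, by rw [h3.2, e1, e2]; rfl⟩
  | smul r x _ hx =>
    obtain ⟨R, hR, A, h⟩ := hx
    refine ⟨fun s => (r : ℂ) * R s, fun s hs => (MeromorphicAt.const _ _).mul (hR s hs), A,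
      fun s hs => ?_⟩
    obtain ⟨c1, e1⟩ := h s hs
    have h3 := hasMellin_const_smul c1 (r : ℂ)
    have e : restrictUnit (r • x) = fun t => (r : ℂ) • restrictUnit x t := by
      funext t
      simp only [restrictUnit, indicator_apply]
      split_ifs <;> simp
    rw [e]
    exact ⟨h3.1, by rw [h3.2, e1]; rfl⟩

namespace IsTame

variable {f : ℝ → ℝ}

theorem isBigO_top_rpow (hf : IsTame (-1) 1 f) (a : ℝ) :
    (fun t => (f t : ℂ)) =O[atTop] fun t : ℝ => t ^ a :=
  Complex.isBigO_ofReal_left.2 ((hf.top (1 / 2) (by norm_num)).trans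
    (isLittleO_exp_neg_mul_rpow_atTop (by norm_num) _).isBigO)

theorem mellinConvergent (hf : IsTame (-1) 1 f) {s : ℂ} (hs : 1 < s.re) :
    MellinConvergent (fun t => (f t : ℂ)) s :=
  mellinConvergent_of_isBigO_rpow (a := s.re + 1) (b := (1 + s.re) / 2)
    (locallyIntegrableOn_ofReal hf.continuousOn) (hf.isBigO_top_rpow _) (by linarith)
    (Complex.isBigO_ofReal_left.2 (hf.zero _ (by linarith))) (by linarith)

theorem analyticAt_mellin (hf : IsTame (-1) 1 f) {s : ℂ} (hs : 1 < s.re) :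
    AnalyticAt ℂ (mellin fun t => (f t : ℂ)) s := by
  rw [Complex.analyticAt_iff_eventually_differentiableAt]
  filter_upwards [(isOpen_re_gt 1).mem_nhds hs] with z hz
  have hz : 1 < z.re := hz
  exact mellin_differentiableAt_of_isBigO_rpow (a := z.re + 1) (b := (1 + z.re) / 2)
    (locallyIntegrableOn_ofReal hf.continuousOn) (hf.isBigO_top_rpow _) (by linarith)
    (Complex.isBigO_ofReal_left.2 (hf.zero _ (by linarith))) (by linarith)

/-- Subtract the expansion of order M on (0,1] only. The remainder is O(t^M) at 0 and decays at
infinity as f does, so its transform is holomorphic for Re s > -M; the subtracted part is explicit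
and meromorphic. -/
theorem exists_meromorphic_mellin_halfPlane (hf : IsTame (-1) 1 f) (M : ℕ) :
    ∃ F : ℂ → ℂ, MeromorphicOn F {s | -(M : ℝ) < s.re} ∧
      ∃ A : ℝ, ∀ s : ℂ, A < s.re → F s = mellin (fun t => (f t : ℂ)) s := by
  obtain ⟨P, hP, hO⟩ := hf.expansion M
  obtain ⟨R, hR, A, h⟩ := exists_meromorphic_mellin_of_mem_logPoly hP
  set g : ℝ → ℂ := fun t => (f t : ℂ) - restrictUnit P t with hg
  have hgl : LocallyIntegrableOn g (Ioi 0) :=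
    (locallyIntegrableOn_ofReal hf.continuousOn).sub
      (locallyIntegrableOn_restrictUnit (continuousOn_of_mem_logPoly hP))
  have hg0 : g =O[𝓝[>] 0] fun t : ℝ => t ^ (-(-(M : ℝ))) := by
    refine (Complex.isBigO_ofReal_left.2 hO).congr' ?_ ?_
    · filter_upwards [restrictUnit_eventuallyEq_zero P] with t ht
      simp [hg, ht]
    · exact Eventually.of_forall fun t => by simp
  have hgt : ∀ a : ℝ, g =O[atTop] fun t : ℝ => t ^ a := fun a =>
    (hf.isBigO_top_rpow a).sub (isBigO_restrictUnit_top P a)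
  refine ⟨fun s => mellin g s + R s, fun s hs => ?_, max A (-(M : ℝ)), fun s hs => ?_⟩
  · refine MeromorphicAt.add (AnalyticAt.meromorphicAt ?_) (hR s (mem_univ s))
    rw [Complex.analyticAt_iff_eventually_differentiableAt]
    filter_upwards [(isOpen_re_gt _).mem_nhds hs] with z hz
    exact mellin_differentiableAt_of_isBigO_rpow (a := z.re + 1) hgl (hgt _) (by linarith) hg0 hz
  · obtain ⟨c1, e1⟩ := h s ((le_max_left _ _).trans_lt hs)
    have c2 : MellinConvergent g s := mellinConvergent_of_isBigO_rpow (a := s.re + 1) hgl (hgt _)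
      (by linarith) hg0 ((le_max_right _ _).trans_lt hs)
    have h3 := (hasMellin_add c2 c1).2
    beta_reduce
    rw [← e1, ← h3]
    congr 1
    funext t
    simp [hg]

theorem exists_meromorphic_mellin (hf : IsTame (-1) 1 f) :
    ∃ F : ℂ → ℂ, MeromorphicOn F univ ∧
      ∀ s : ℂ, 1 < s.re → F =ᶠ[𝓝[≠] s] mellin (fun t => (f t : ℂ)) := by
  obtain ⟨F, hF, A, hA⟩ := exists_meromorphic_of_halfPlanes hf.exists_meromorphic_mellin_halfPlane
  exact ⟨F, hF, fun s hs => MeromorphicOn.eventuallyEq_of_halfPlane (hF.mono_set (subset_univ _))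
    (fun z hz => (hf.analyticAt_mellin hz).meromorphicAt) hA hs⟩

end IsTame

/-! ### Dirichlet series as Mellin transforms of exponential series. -/

namespace IsExpSeries

variable {ι : Type*} {c : ι → ℝ} {p : ι → ℕ} {f : ℝ → ℝ}

theorem summable_div_cpow (hf : IsExpSeries c p f) (hp : ∀ i, 1 ≤ p i) (ht : IsTame (-1) 1 f)
    {z : ℂ} (hz : 1 < z.re) : Summable fun i => (c i : ℂ) / (p i : ℂ) ^ z := by
  refine Summable.of_norm ((hf.summable_div_rpow hp ht hz).congr fun i => ?_)
  rw [norm_div, Complex.norm_natCast_cpow_of_pos (hp i), Complex.norm_real,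
    Real.norm_of_nonneg (hf.nonneg i)]

theorem mellin_eq [Countable ι] (hf : IsExpSeries c p f) (hp : ∀ i, 1 ≤ p i)
    (ht : IsTame (-1) 1 f) {z : ℂ} (hz : 1 < z.re) :
    mellin (fun t => (f t : ℂ)) z = Complex.Gamma z * ∑' i, (c i : ℂ) / (p i : ℂ) ^ z := by
  have h := hasSum_mellin (a := fun i => (c i : ℂ)) (p := fun i => (p i : ℝ)) (s := z)
    (F := fun t => (f t : ℂ)) (fun i => Or.inr (by exact_mod_cast hp i)) (by linarith)
    (fun t h0 => by
      have := Complex.hasSum_ofReal.2 (hf.hasSum t h0)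
      push_cast at this ⊢
      exact this)
    ((hf.summable_div_rpow hp ht hz).congr fun i => by
      rw [Complex.norm_real, Real.norm_of_nonneg (hf.nonneg i)])
  rw [← h.tsum_eq, ← tsum_mul_left]
  refine tsum_congr fun i => ?_
  push_cast
  rw [mul_div_assoc]

theorem tsum_eq_mellin [Countable ι] (hf : IsExpSeries c p f) (hp : ∀ i, 1 ≤ p i)
    (ht : IsTame (-1) 1 f) {z : ℂ} (hz : 1 < z.re) :
    ∑' i, (c i : ℂ) / (p i : ℂ) ^ z =
      (Complex.Gamma z)⁻¹ * mellin (fun t => (f t : ℂ)) z := by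
  rw [hf.mellin_eq hp ht hz, inv_mul_cancel_left₀]
  exact Complex.Gamma_ne_zero_of_re_pos (by linarith)

/-- Divide the continued Mellin transform by Γ, whose reciprocal is entire. The shift d accommodates
the last argument c_{q+1} + s. -/
theorem exists_isMeromorphicContinuation [Countable ι] (hf : IsExpSeries c p f)
    (hp : ∀ i, 1 ≤ p i) (ht : IsTame (-1) 1 f) (d : ℕ) :
    ∃ Z : ℂ → ℂ,
      IsMeromorphicContinuation (fun s => ∑' i, (c i : ℂ) / (p i : ℂ) ^ (s + d)) 1 Z := by
  obtain ⟨F, hF, h⟩ := ht.exists_meromorphic_mellin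
  have hre : ∀ s : ℂ, 1 < s.re → 1 < (s + d).re := fun s hs => by
    simp only [Complex.add_re, Complex.natCast_re]
    linarith [(Nat.cast_nonneg d : (0 : ℝ) ≤ d)]
  have hΓ : ∀ s : ℂ, AnalyticAt ℂ (fun s : ℂ => (Complex.Gamma (s + d))⁻¹) s := fun s =>
    Differentiable.analyticAt
      (Complex.differentiable_one_div_Gamma.comp (differentiable_id.add_const _)) s
  have hsh : ∀ s : ℂ, AnalyticAt ℂ (fun s : ℂ => s + d) s := fun s => by fun_prop
  have hf' : ∀ s : ℂ, 1 < s.re →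
      (fun s => ∑' i, (c i : ℂ) / (p i : ℂ) ^ (s + d)) =ᶠ[𝓝 s]
        fun s => (Complex.Gamma (s + d))⁻¹ * mellin (fun t => (f t : ℂ)) (s + d) := fun s hs => by
    filter_upwards [(isOpen_re_gt 1).mem_nhds hs] with z hz
    exact hf.tsum_eq_mellin hp ht (hre z hz)
  refine ⟨_, isMeromorphicContinuation_toMeromorphicNFOn
    (F := fun s => (Complex.Gamma (s + d))⁻¹ * F (s + d)) ?_ ?_ ?_⟩
  · intro s _
    exact (hΓ s).meromorphicAt.mul 
      ((hF (s + d) (mem_univ _)).comp_analyticAt (g := fun s : ℂ => s + d) (hsh s))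
  · intro s hs
    refine AnalyticAt.congr ((hΓ s).mul ?_) (hf' s hs).symm
    exact (ht.analyticAt_mellin (hre s hs)).comp_of_eq (hsh s) rfl
  · intro s hs
    have h1 : Tendsto (fun z : ℂ => z + d) (𝓝[≠] s) (𝓝[≠] (s + d)) :=
      tendsto_nhdsWithin_of_tendsto_nhds_of_eventually_within _
        ((hsh s).continuousAt.tendsto.mono_left nhdsWithin_le_nhds)
        (by filter_upwards [self_mem_nhdsWithin] with z hz using fun e => hz (add_right_cancel e))
    filter_upwards [h1.eventually (h (s + d) (hre s hs)),
      (hf' s hs).filter_mono nhdsWithin_le_nhds] with z hz hz'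
    rw [hz', hz]

end IsExpSeries

/-! ### The generalized Mordell-Tornheim series as Dirichlet series. -/

theorem exists_nat_tuple_of_map_cast (L : List ℕ) {K : List ℂ} (h : K = L.map (fun x : ℕ => (x : ℂ))) :
    ∃ ν : Fin K.length → ℕ, (∀ x, K.get x = (ν x : ℂ)) ∧ List.ofFn ν = L := by
  subst h
  refine ⟨fun x => L.get (x.cast (by simp)), fun x => by simp, ?_⟩
  refine List.ext_get (by simp) fun i h1 h2 => by simp

/-- The real coefficient of the generalized Mordell-Tornheim series. -/
noncomputable def gmtCoeff {r p : ℕ} {s : Fin r → List ℂ} (ν : ∀ i, Fin (s i).length → ℕ)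
    (x : Fin p → ℕ) (m : ((i : Fin r) → Fin (s i).length → ℕ+) × (Fin p → ℕ+)) : ℝ :=
  (∏ i, blockCoeff (ν i) (m.1 i)) *
    ∏ u, 1 / ((∑ i, ∑ j, (m.1 i j : ℕ) +
      ∑ v ∈ Finset.univ.filter (fun v => v < u), (m.2 v : ℕ) : ℕ) : ℝ) ^ x u

/-- Only the last argument is a genuine complex exponent, and its base is the total of all
variables. That total is the exponent p of the exponential series. -/
theorem gmtTerm_eq {r p : ℕ} {s : Fin r → List ℂ} {w : Fin (p + 1) → ℂ}
    {ν : ∀ i, Fin (s i).length → ℕ} (hν : ∀ i x, (s i).get x = (ν i x : ℂ)) {x : Fin p → ℕ}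
    (hw : ∀ u : Fin p, w u.castSucc = (x u : ℂ))
    (m : ((i : Fin r) → Fin (s i).length → ℕ+) × (Fin p → ℕ+)) :
    gmtTerm s w m = (gmtCoeff ν x m : ℂ) /
      ((∑ i, ∑ j, (m.1 i j : ℕ) + ∑ v, (m.2 v : ℕ) : ℕ) : ℂ) ^ w (Fin.last p) := by
  rw [gmtTerm, gmtCoeff, Fin.prod_univ_castSucc]
  simp only [hν, hw, Complex.cpow_natCast, Fin.castSucc_lt_castSucc_iff, Fin.castSucc_lt_last,
    Finset.filter_true, blockCoeff]
  push_cast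
  simp only [one_div, Finset.prod_inv_distrib]
  rw [← mul_assoc, mul_inv, mul_inv, div_eq_mul_inv]

theorem kTuple_eq_map (j k : ℕ) : kTuple j k = (kList j k).map (fun x : ℕ => (x : ℂ)) := by
  unfold kTuple kList onesTwoOnes
  split_ifs <;> simp

theorem zeroBlocks_eq_map {n : ℕ} (j k : Fin n → ℕ) (i : Fin (n + 1)) :
    zeroBlocks j k i = (Fin.cons (α := fun _ => List ℕ) [0] (fun i => kList (j i) (k i)) i :
      List ℕ).map (fun x : ℕ => (x : ℂ)) := by
  refine Fin.cases ?_ (fun i => ?_) i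
  · simp [zeroBlocks]
  · simp [zeroBlocks, kTuple_eq_map]

/-- The block 0 is the kernel itself: an entry 0 means multiplication by 1/(e^t - 1) followed by no
tail integral. It also keeps the total positive when all other blocks are empty. -/
theorem isExpSeries_zeroBlocks {n : ℕ} (j k : Fin n → ℕ) :
    ∃ ν : ∀ i, Fin (zeroBlocks j k i).length → ℕ, (∀ i x, (zeroBlocks j k i).get x = (ν i x : ℂ)) ∧
      IsExpSeries (fun m : (i : Fin (n + 1)) → Fin (zeroBlocks j k i).length → ℕ+ =>
        ∏ i, blockCoeff (ν i) (m i)) (fun m => ∑ i, ∑ x, (m i x : ℕ))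
        (fun t => boseKernel t * kListProd j k t) := by
  choose ν hν hL using fun i => exists_nat_tuple_of_map_cast _ (zeroBlocks_eq_map j k i)
  refine ⟨ν, hν, ?_⟩
  refine (IsExpSeries.pi_prod fun i => isExpSeries_polyTail (ν i)).congr fun t _ => ?_
  simp only [hL]
  rw [Fin.prod_univ_succ]
  simp [kListProd, listPolylog]

theorem one_le_sum_zeroBlocks {n : ℕ} (j k : Fin n → ℕ)
    (m : (i : Fin (n + 1)) → Fin (zeroBlocks j k i).length → ℕ+) :
    1 ≤ ∑ i, ∑ x, (m i x : ℕ) := by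
  rw [Fin.sum_univ_succ]
  refine le_add_right ?_
  exact one_le_sum_pnat_of_pos (by simp [zeroBlocks]) (m 0)

theorem isExpSeries_gmt {n q : ℕ} (j k : Fin n → ℕ) (c : Fin (q + 1) → ℕ) :
    ∃ C : ((i : Fin (n + 1)) → Fin (zeroBlocks j k i).length → ℕ+) × (Fin q → ℕ+) → ℝ,
    ∃ P : ((i : Fin (n + 1)) → Fin (zeroBlocks j k i).length → ℕ+) × (Fin q → ℕ+) → ℕ,
      (∀ m, 1 ≤ P m) ∧
      IsExpSeries C P (fun t => boseKernel t * polyTail (kListProd j k)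
        (List.ofFn fun u : Fin q => c u.castSucc + 1) t) ∧
      ∀ s m, gmtTerm (zeroBlocks j k) (cIndex c s) m =
        (C m : ℂ) / (P m : ℂ) ^ (s + c (Fin.last q)) := by
  obtain ⟨ν, hν, h⟩ := isExpSeries_zeroBlocks j k
  refine ⟨gmtCoeff ν fun u => c u.castSucc + 1, _, fun m =>
    (one_le_sum_zeroBlocks j k m.1).trans (Nat.le_add_right _ _),
    h.boseKernel_mul_polyTail (one_le_sum_zeroBlocks j k) fun u => c u.castSucc + 1,
    fun s m => ?_⟩
  rw [gmtTerm_eq hν (x := fun u => c u.castSucc + 1) (fun u => by simp [cIndex])]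
  simp [cIndex, add_comm]

theorem isTame_gmt {n q : ℕ} (j k : Fin n → ℕ) (c : Fin (q + 1) → ℕ) :
    IsTame (-1) 1 (fun t => boseKernel t * polyTail (kListProd j k)
      (List.ofFn fun u : Fin q => c u.castSucc + 1) t) :=
  ((isTame_kListProd j k).polyTail fun x hx => by
    obtain ⟨i, rfl⟩ := List.mem_ofFn.1 hx
    exact Nat.le_add_left _ _).boseKernel_mul

/-- The bijection between `Fin r → ℕ+` and the index set of `ζ_MT({1}^l, 𝐤; i)`. -/
def onesBlocksEquiv {n : ℕ} (l : ℕ) (k : Fin n → ℕ) : (Fin (l + n) → ℕ+) ≃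
    ((i : Fin (l + n)) → Fin (onesBlocks l k i).length → ℕ+) × (Fin 0 → ℕ+) where
  toFun m := (fun i _ => m i, Fin.elim0)
  invFun x i := x.1 i ⟨0, Nat.one_pos⟩
  left_inv _ := rfl
  right_inv x := by
    refine Prod.ext ?_ (Subsingleton.elim _ _)
    funext i y
    exact congrArg (x.1 i) (Subsingleton.elim (α := Fin 1) _ _)

theorem gmtTerm_onesBlocks {n : ℕ} (l : ℕ) (k : Fin n → ℕ) (i : ℕ) (m : Fin (l + n) → ℕ+) :
    gmtTerm (onesBlocks l k) (fun _ : Fin 1 => (i : ℂ)) (onesBlocksEquiv l k m) =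
      ((1 / mtDenom (onesAppend l k) i m : ℝ) : ℂ) := by
  have h : ∀ a : Fin (l + n), ∏ x : Fin (onesBlocks l k a).length,
      ((∑ y ∈ Finset.univ.filter (fun y => y ≤ x), ((onesBlocksEquiv l k m).1 a y : ℕ) : ℕ) : ℂ) ^
        (onesBlocks l k a).get x = ((m a : ℕ) : ℂ) ^ onesAppend l k a := fun a => by
    change ∏ x : Fin 1, _ = _
    simp only [Finset.univ_unique, Finset.prod_singleton]
    have e : (onesBlocks l k a).get (default : Fin 1) = (onesAppend l k a : ℂ) := rfl
    rw [e, Complex.cpow_natCast]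
    congr 2
  have h2 : ∀ a : Fin (l + n), ∑ y : Fin (onesBlocks l k a).length,
      ((onesBlocksEquiv l k m).1 a y : ℕ) = m a := fun a => by
    change ∑ y : Fin 1, (m a : ℕ) = m a
    simp
  rw [gmtTerm]
  simp only [h, h2]
  simp [mtDenom]

theorem summable_gmtTerm_onesBlocks {n : ℕ} (hn : 1 ≤ n) (l : ℕ) {k : Fin n → ℕ}
    (hk : ∀ i, 2 ≤ k i) {i : ℕ} (hi : 1 ≤ i) :
    Summable (gmtTerm (onesBlocks l k) (fun _ : Fin 1 => (i : ℂ))) := by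
  rw [← (onesBlocksEquiv l k).summable_iff]
  refine (Complex.summable_ofReal.2 (summable_one_div_mtDenom (by omega)
    (one_le_onesAppend l hk) hi)).congr fun m => ?_
  exact (gmtTerm_onesBlocks l k i m).symm

theorem gmtZeta_onesBlocks {n : ℕ} (l : ℕ) (k : Fin n → ℕ) (i : ℕ) :
    gmtZeta (onesBlocks l k) (fun _ : Fin 1 => (i : ℂ)) = (mtValue (onesAppend l k) i : ℂ) := by
  rw [gmtZeta, ← (onesBlocksEquiv l k).tsum_eq, mtValue, Complex.ofReal_tsum]
  exact tsum_congr fun m => gmtTerm_onesBlocks l k i m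

theorem aCoeff_eq (j k : ℕ) : aCoeff j k = (aReal j k : ℂ) := by
  unfold aCoeff aReal
  split_ifs with h
  · rw [zeta_eq_tsum_one_div_nat_add_one_cpow (by
        rw [Complex.natCast_re]
        exact_mod_cast (by omega : 1 < k - j)), zetaValue_eq_tsum,
      show k - 1 - j + 1 = k - j by omega, ← Equiv.pnatEquivNat.tsum_eq]
    push_cast
    congr 1
    refine tsum_congr fun m => ?_
    have hm : ((m : ℕ) : ℂ) = (Equiv.pnatEquivNat m : ℂ) + 1 := by
      exact_mod_cast (PNat.natPred_add_one m).symm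
    rw [Complex.cpow_natCast, hm]
  · push_cast
    rfl

/-! ### The Euler-Zagier series, via partial sums. -/

/-- The partial sum `m_0 + ⋯ + m_i` as a positive integer. -/
def pnatPartialSum {d : ℕ} (m : Fin d → ℕ+) (i : Fin d) : ℕ+ :=
  ⟨∑ j ∈ Finset.univ.filter (fun j => j ≤ i), (m j : ℕ),
    (m i).pos.trans_le (Finset.single_le_sum (f := fun j => (m j : ℕ)) (fun _ _ => Nat.zero_le _)
      (by simp))⟩

theorem coe_pnatPartialSum {d : ℕ} (m : Fin d → ℕ+) (i : Fin d) :
    (pnatPartialSum m i : ℕ) = ∑ j ∈ Finset.univ.filter (fun j => j ≤ i), (m j : ℕ) := rfl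

theorem coe_pnatPartialSum_zero {d : ℕ} (m : Fin (d + 1) → ℕ+) :
    (pnatPartialSum m 0 : ℕ) = m 0 := by
  have : Finset.univ.filter (fun j : Fin (d + 1) => j ≤ 0) = {0} := by
    ext j
    simp
  rw [coe_pnatPartialSum, this, Finset.sum_singleton]

theorem coe_pnatPartialSum_succ {d : ℕ} (m : Fin (d + 1) → ℕ+) (i : Fin d) :
    (pnatPartialSum m i.succ : ℕ) = pnatPartialSum m i.castSucc + m i.succ := by
  have : Finset.univ.filter (fun j : Fin (d + 1) => j ≤ i.succ) =
      insert i.succ (Finset.univ.filter (fun j : Fin (d + 1) => j ≤ i.castSucc)) := by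
    ext j
    simp only [Finset.mem_filter, Finset.mem_univ, true_and, Finset.mem_insert, Fin.le_def,
      Fin.ext_iff, Fin.val_succ, Fin.val_castSucc]
    omega
  rw [coe_pnatPartialSum, coe_pnatPartialSum, this, Finset.sum_insert (by simp [Fin.le_def]),
    add_comm]

theorem strictMono_pnatPartialSum {d : ℕ} (m : Fin (d + 1) → ℕ+) :
    StrictMono (pnatPartialSum m) := by
  rw [Fin.strictMono_iff_lt_succ]
  intro i
  rw [← PNat.coe_lt_coe, coe_pnatPartialSum_succ]
  exact Nat.lt_add_of_pos_right (m i.succ).pos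

/-- The bijection `m ↦ (m_0 + ⋯ + m_i)_i` onto the strictly increasing tuples. -/
noncomputable def strictMonoEquiv (d : ℕ) :
    (Fin (d + 1) → ℕ+) ≃ {m : Fin (d + 1) → ℕ+ // StrictMono m} :=
  Equiv.ofBijective (fun m => ⟨pnatPartialSum m, strictMono_pnatPartialSum m⟩) <| by
    constructor
    · intro m m' h
      have h' : ∀ i, (pnatPartialSum m i : ℕ) = pnatPartialSum m' i := fun i => by
        exact congrArg PNat.val (congrFun (congrArg Subtype.val h) i)
      funext i
      refine PNat.eq ?_
      refine Fin.cases ?_ (fun i => ?_) i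
      · have := h' 0
        rwa [coe_pnatPartialSum_zero, coe_pnatPartialSum_zero] at this
      · have h1 := h' i.succ
        rw [coe_pnatPartialSum_succ, coe_pnatPartialSum_succ, h' i.castSucc] at h1
        exact Nat.add_left_cancel h1
    · rintro ⟨a, ha⟩
      refine ⟨Fin.cons (a 0) fun i => a i.succ - a i.castSucc, Subtype.ext (funext fun i => ?_)⟩
      refine PNat.eq ?_
      induction i using Fin.induction with
      | zero => simp [coe_pnatPartialSum_zero]
      | succ i ih =>
        change (pnatPartialSum _ i.castSucc : ℕ) = _ at ih
        change (pnatPartialSum _ i.succ : ℕ) = _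
        have h1 := ha (Fin.castSucc_lt_succ (i := i))
        rw [coe_pnatPartialSum_succ, ih, Fin.cons_succ, PNat.sub_coe, if_pos h1]
        exact Nat.add_sub_of_le (PNat.coe_le_coe _ _ |>.2 h1.le)

theorem ezTerm_strictMonoEquiv (d : ℕ) (s : ℂ) (m : Fin (d + 1) → ℕ+) :
    ezTerm (onesSnoc d s) (strictMonoEquiv d m) =
      (blockCoeff (fun _ : Fin d => 1) (Fin.init m) : ℂ) / ((∑ j, (m j : ℕ) : ℕ) : ℂ) ^ s := by
  have h : ∀ i, ((strictMonoEquiv d m).1 i : ℕ) =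
      ∑ j ∈ Finset.univ.filter (fun j => j ≤ i), (m j : ℕ) := fun i => rfl
  have h2 : ∀ k : Fin d, ∑ j ∈ Finset.univ.filter (fun j => j ≤ k), (Fin.init m j : ℕ) =
      ∑ j ∈ Finset.univ.filter (fun j => j ≤ k.castSucc), (m j : ℕ) := fun k => by
    rw [← sum_filter_le_castSucc k (Fin.init m) (m (Fin.last d)), Fin.snoc_init_self]
  rw [ezTerm, Fin.prod_univ_castSucc, blockCoeff]
  simp only [h, h2, onesSnoc, Fin.snoc_castSucc, Fin.snoc_last, Complex.cpow_one, Fin.le_last,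
    Finset.filter_true, pow_one]
  push_cast
  simp only [one_div, Finset.prod_inv_distrib]
  rw [mul_inv, div_eq_mul_inv]

theorem isExpSeries_ez (d : ℕ) :
    IsExpSeries (fun m : Fin (d + 1) → ℕ+ => blockCoeff (fun _ : Fin d => 1) (Fin.init m))
      (fun m => ∑ j, (m j : ℕ))
      (fun t => boseKernel t * listPolylog (List.replicate d 1) t) := by
  have h := isExpSeries_boseKernel_mul_polyTail (isExpSeries_polyTail fun _ : Fin d => 1)
  rwa [List.ofFn_const] at h

theorem isTame_ez (d : ℕ) :
    IsTame (-1) 1 (fun t => boseKernel t * listPolylog (List.replicate d 1) t) :=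
  (isTame_listPolylog_ones d).boseKernel_mul

theorem summable_ezTerm (d : ℕ) {s : ℂ} (hs : 1 < s.re) : Summable (ezTerm (onesSnoc d s)) := by
  rw [← (strictMonoEquiv d).summable_iff]
  exact ((isExpSeries_ez d).summable_div_cpow one_le_sum_pnat (isTame_ez d) hs).congr fun m =>
    (ezTerm_strictMonoEquiv d s m).symm

theorem ezZeta_onesSnoc (d : ℕ) (s : ℂ) : ezZeta (onesSnoc d s) =
    ∑' m : Fin (d + 1) → ℕ+, (blockCoeff (fun _ : Fin d => 1) (Fin.init m) : ℂ) /
      ((∑ j, (m j : ℕ) : ℕ) : ℂ) ^ s := by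
  rw [ezZeta, ← (strictMonoEquiv d).tsum_eq]
  exact tsum_congr fun m => ezTerm_strictMonoEquiv d s m

theorem mellin_ez (d : ℕ) {s : ℂ} (hs : 1 < s.re) :
    mellin (fun t => ((boseKernel t * listPolylog (List.replicate d 1) t : ℝ) : ℂ)) s =
      Complex.Gamma s * ezZeta (onesSnoc d s) := by
  rw [ezZeta_onesSnoc]
  exact (isExpSeries_ez d).mellin_eq one_le_sum_pnat (isTame_ez d) hs

theorem exists_isMeromorphicContinuation_ez (d : ℕ) :
    ∃ E : ℂ → ℂ, IsMeromorphicContinuation (fun s => ezZeta (onesSnoc d s)) 1 E := by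
  simp only [ezZeta_onesSnoc]
  simpa only [Nat.cast_zero, add_zero] using
    (isExpSeries_ez d).exists_isMeromorphicContinuation one_le_sum_pnat (isTame_ez d) 0

/-! ### Convergence, Mellin transforms and continuation of the Mordell-Tornheim series. -/

section

variable {n q : ℕ} (j k : Fin n → ℕ) (c : Fin (q + 1) → ℕ)

theorem one_lt_re_add_natCast {s : ℂ} (hs : 1 < s.re) (d : ℕ) : 1 < (s + d).re := by
  simp only [Complex.add_re, Complex.natCast_re]
  linarith [(Nat.cast_nonneg d : (0 : ℝ) ≤ d)]

theorem summable_gmtTerm_zeroBlocks {s : ℂ} (hs : 1 < s.re) :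
    Summable (gmtTerm (zeroBlocks j k) (cIndex c s)) := by
  obtain ⟨C, P, hP, h, he⟩ := isExpSeries_gmt j k c
  refine (h.summable_div_cpow hP (isTame_gmt j k c) (one_lt_re_add_natCast hs (c (Fin.last q)))).congr
    fun m => (he s m).symm

theorem mellin_gmt {s : ℂ} (hs : 1 < s.re) :
    mellin (fun t => ((boseKernel t * polyTail (kListProd j k)
      (List.ofFn fun u : Fin q => c u.castSucc + 1) t : ℝ) : ℂ)) (s + c (Fin.last q)) =
      Complex.Gamma (s + c (Fin.last q)) * gmtZeta (zeroBlocks j k) (cIndex c s) := by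
  obtain ⟨C, P, hP, h, he⟩ := isExpSeries_gmt j k c
  rw [gmtZeta, tsum_congr (he s)]
  exact h.mellin_eq hP (isTame_gmt j k c) (one_lt_re_add_natCast hs _)

theorem exists_isMeromorphicContinuation_gmt :
    ∃ Z : ℂ → ℂ, IsMeromorphicContinuation
      (fun s => gmtZeta (zeroBlocks j k) (cIndex c s)) 1 Z := by
  obtain ⟨C, P, hP, h, he⟩ := isExpSeries_gmt j k c
  simp only [gmtZeta, he]
  exact h.exists_isMeromorphicContinuation hP (isTame_gmt j k c) _

end

/-! ### Binomial coefficients and quotients of Gamma values. -/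

theorem ringChoose_eq (s : ℂ) (d : ℕ) :
    Ring.choose (s + d - 1) d = (ascPochhammer ℂ d).eval s / d.factorial := by
  have h := Ring.factorial_nsmul_multichoose_eq_ascPochhammer s d
  rw [Polynomial.ascPochhammer_smeval_eq_eval, nsmul_eq_mul] at h
  rw [Ring.choose, show s + d - 1 - d + 1 = s by ring, ← h, mul_div_cancel_left₀]
  exact_mod_cast d.factorial_ne_zero

theorem Gamma_add_natCast {s : ℂ} (hs : 0 < s.re) (d : ℕ) :
    Complex.Gamma (s + d) = (ascPochhammer ℂ d).eval s * Complex.Gamma s := by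
  induction d with
  | zero => simp
  | succ d ih =>
    have h : s + d ≠ 0 := fun h => by
      have := congrArg Complex.re h
      simp only [Complex.add_re, Complex.natCast_re, Complex.zero_re] at this
      linarith [(Nat.cast_nonneg d : (0 : ℝ) ≤ d)]
    rw [Nat.cast_succ, ← add_assoc, Complex.Gamma_add_one _ h, ih, ascPochhammer_succ_right]
    simp
    ring

theorem Gamma_add_natCast_div {s : ℂ} (hs : 0 < s.re) (d : ℕ) :
    Complex.Gamma (s + d) / d.factorial = Ring.choose (s + d - 1) d * Complex.Gamma s := by
  rw [Gamma_add_natCast hs, ringChoose_eq]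
  ring

theorem analyticAt_ringChoose (d : ℕ) (s : ℂ) :
    AnalyticAt ℂ (fun s : ℂ => Ring.choose (s + d - 1) d) s := by
  simp only [ringChoose_eq]
  exact (Polynomial.differentiable _).div_const _ |>.analyticAt s

/-! ### The Ito zeta function as a Mellin transform. -/

section

variable {r : ℕ}

theorem multiLi_eq (h : Fin r → ℕ) (q : ℕ) (t : ℝ) :
    multiLi h q (1 - Complex.exp (-(t : ℂ))) = (mtPolylog h q t : ℂ) := by
  rw [multiLi, mtPolylog, Complex.ofReal_tsum]
  refine tsum_congr fun m => ?_
  simp [mtDenom]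

theorem itoIntegrand_eq (h : Fin r → ℕ) (q : ℕ) (s : ℂ) (t : ℝ) :
    itoIntegrand h q s t = (t : ℂ) ^ (s - 1) • ((boseKernel t * mtPolylog h q t : ℝ) : ℂ) := by
  rw [itoIntegrand, multiLi_eq, boseKernel, smul_eq_mul]
  push_cast
  ring

variable {h : Fin r → ℕ}

theorem isTame_boseKernel_mul_mtPolylog (hr : 0 < r) (hh : ∀ i, 1 ≤ h i) (q : ℕ) :
    IsTame (-1) 1 (fun t => boseKernel t * mtPolylog h q t) :=
  (isTame_mtPolylog hr hh q).boseKernel_mul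

/-- From kernel ≤ 1/t and Li ≤ t^r. Tameness alone gives order -1 and only Re s > 1; this order r -
1 gives Re s > 1 - r. -/
theorem isBigO_boseKernel_mul_mtPolylog (hr : 0 < r) (hh : ∀ i, 1 ≤ h i) (q : ℕ) :
    (fun t => ((boseKernel t * mtPolylog h q t : ℝ) : ℂ)) =O[𝓝[>] 0]
      fun t : ℝ => t ^ (-(1 - (r : ℝ))) := by
  refine IsBigO.of_bound 1 ?_
  filter_upwards [self_mem_nhdsWithin] with t ht
  have ht : 0 < t := ht
  have h1 : boseKernel t ≤ t⁻¹ := by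
    rw [boseKernel, one_div]
    exact inv_anti₀ ht (by linarith [Real.add_one_le_exp t])
  rw [Complex.norm_real, Real.norm_of_nonneg (mul_nonneg (boseKernel_pos ht).le
    (mtPolylog_nonneg h q ht)), one_mul, Real.norm_of_nonneg (by positivity), neg_sub,
    Real.rpow_sub_one ht.ne', Real.rpow_natCast, div_eq_inv_mul]
  exact mul_le_mul h1 (mtPolylog_le hr hh q ht) (mtPolylog_nonneg h q ht) (by positivity)

theorem integrableOn_itoIntegrand (hr : 0 < r) (hh : ∀ i, 1 ≤ h i) (q : ℕ) {s : ℂ}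
    (hs : 1 - (r : ℝ) < s.re) : IntegrableOn (itoIntegrand h q s) (Ioi 0) := by
  have ht := isTame_boseKernel_mul_mtPolylog hr hh q
  have := mellinConvergent_of_isBigO_rpow (a := s.re + 1)
    (locallyIntegrableOn_ofReal ht.continuousOn) (ht.isBigO_top_rpow _) (by linarith)
    (isBigO_boseKernel_mul_mtPolylog hr hh q) hs
  exact this.congr_fun (fun t _ => (itoIntegrand_eq h q s t).symm) measurableSet_Ioi

theorem itoZeta_eq (h : Fin r → ℕ) (q : ℕ) (s : ℂ) : itoZeta h q s =
    (Complex.Gamma s)⁻¹ * mellin (fun t => ((boseKernel t * mtPolylog h q t : ℝ) : ℂ)) s := by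
  rw [itoZeta, one_div]
  simp only [itoIntegrand_eq, mellin]

theorem analyticAt_itoZeta (hr : 0 < r) (hh : ∀ i, 1 ≤ h i) (q : ℕ) {s : ℂ}
    (hs : 1 - (r : ℝ) < s.re) : AnalyticAt ℂ (itoZeta h q) s := by
  have ht := isTame_boseKernel_mul_mtPolylog hr hh q
  rw [Complex.analyticAt_iff_eventually_differentiableAt]
  filter_upwards [(isOpen_re_gt _).mem_nhds hs] with z hz
  have h1 := mellin_differentiableAt_of_isBigO_rpow (a := z.re + 1)
    (locallyIntegrableOn_ofReal ht.continuousOn) (ht.isBigO_top_rpow _) (by linarith)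
    (isBigO_boseKernel_mul_mtPolylog hr hh q) hz
  simp only [funext (itoZeta_eq h q)]
  exact (Complex.differentiable_one_div_Gamma z).mul h1

end

/-! ### The functional relation for Re s > 1 and its continuation. -/

namespace IsTame

variable {f g : ℝ → ℝ} {s : ℂ}

theorem mellin_const_mul (f : ℝ → ℝ) (s : ℂ) (c : ℝ) :
    mellin (fun t => ((c * f t : ℝ) : ℂ)) s = c * mellin (fun t => (f t : ℂ)) s := by
  simpa only [Complex.ofReal_mul, smul_eq_mul] using
    _root_.mellin_const_smul (fun t => (f t : ℂ)) s (c : ℂ)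

theorem mellin_add (hf : IsTame (-1) 1 f) (hg : IsTame (-1) 1 g) (hs : 1 < s.re) :
    mellin (fun t => ((f t + g t : ℝ) : ℂ)) s =
      mellin (fun t => (f t : ℂ)) s + mellin (fun t => (g t : ℂ)) s := by
  simpa only [Complex.ofReal_add] using
    (hasMellin_add (hf.mellinConvergent hs) (hg.mellinConvergent hs)).2

theorem mellin_sum {ι : Type*} (S : Finset ι) {F : ι → ℝ → ℝ}
    (h : ∀ i ∈ S, IsTame (-1) 1 (F i)) (hs : 1 < s.re) :
    mellin (fun t => ((∑ i ∈ S, F i t : ℝ) : ℂ)) s =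
      ∑ i ∈ S, mellin (fun t => (F i t : ℂ)) s := by
  classical
  induction S using Finset.induction_on with
  | empty => simp [mellin]
  | insert i S hi ih =>
    simp only [Finset.sum_insert hi]
    rw [(h i (by simp)).mellin_add (IsTame.sum S fun j hj => h j (by simp [hj])) hs,
      ih fun j hj => h j (by simp [hj])]

end IsTame

theorem mellin_dividedPower_mul (d : ℕ) (f : ℝ → ℝ) (s : ℂ) :
    mellin (fun t => ((dividedPower d t * f t : ℝ) : ℂ)) s =
      (d.factorial : ℂ)⁻¹ * mellin (fun t => (f t : ℂ)) (s + d) := by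
  rw [← mellin_cpow_smul, ← smul_eq_mul, ← mellin_const_smul]
  congr 1
  funext t
  simp only [dividedPower, Complex.cpow_natCast, smul_eq_mul]
  push_cast
  ring

theorem mellin_congr {f g : ℝ → ℂ} (h : EqOn f g (Ioi 0)) (s : ℂ) : mellin f s = mellin g s :=
  setIntegral_congr_fun measurableSet_Ioi fun t ht => by
    rw [h ht]

/-- The functional relation in the half-plane of absolute convergence. -/
theorem neg_one_pow_mul_itoZeta {n : ℕ} (hn : 1 ≤ n) (l : ℕ) {k : Fin n → ℕ}
    (hk : ∀ i, 2 ≤ k i) (q : ℕ) {s : ℂ} (hs : 1 < s.re) :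
    (-1) ^ q * itoZeta (onesAppend l k) q s =
      relationRHS l k q (fun j c s => gmtZeta (zeroBlocks j k) (cIndex c s))
        (fun d s => ezZeta (onesSnoc d s)) s := by
  have hΓ : Complex.Gamma s ≠ 0 := Complex.Gamma_ne_zero_of_re_pos (by linarith)
  have h1 : EqOn (fun t => (((-1) ^ q * (boseKernel t * mtPolylog (onesAppend l k) q t) : ℝ) : ℂ))
      (fun t => (((∑ j ∈ Fintype.piFinset (fun i => Finset.Icc 0 (2 * k i - 2)),
        ∑ c ∈ Finset.Nat.antidiagonalTuple (q + 1) (l + bCount j k),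
          ((l + bCount j k).factorial * ∏ i, aReal (j i) (k i)) *
            (dividedPower (c (Fin.last q)) t * (boseKernel t * polyTail (kListProd j k)
              (List.ofFn fun u : Fin q => c u.castSucc + 1) t))) +
      ∑ i ∈ Finset.Icc 1 q, (-((-1) ^ (i - 1) * mtValue (onesAppend l k) i)) *
        (boseKernel t * listPolylog (List.replicate (q - i) 1) t) : ℝ) : ℂ)) (Ioi 0) := by
    intro t ht
    have h := neg_one_pow_mul_mtPolylog_onesAppend hn l hk q ht
    beta_reduce at h ⊢
    rw [mul_left_comm, h, mul_sub, Finset.mul_sum, Finset.mul_sum, sub_eq_add_neg,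
      ← Finset.sum_neg_distrib]
    congr 2
    · refine Finset.sum_congr rfl fun j _ => ?_
      rw [Finset.mul_sum]
      exact Finset.sum_congr rfl fun c _ => by ring
    · exact Finset.sum_congr rfl fun i _ => by ring
  have hG : ∀ (j : Fin n → ℕ) (c : Fin (q + 1) → ℕ), IsTame (-1) 1 (fun t =>
      ((l + bCount j k).factorial * ∏ i, aReal (j i) (k i)) * (dividedPower (c (Fin.last q)) t *
        (boseKernel t * polyTail (kListProd j k)
          (List.ofFn fun u : Fin q => c u.castSucc + 1) t))) := fun j c =>
    (((IsTame.dividedPower _).mul (isTame_gmt j k c)).mono (by simp) (by simp)).const_mul _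
  have hE : ∀ i, IsTame (-1) 1 (fun t => (-((-1) ^ (i - 1) * mtValue (onesAppend l k) i)) *
      (boseKernel t * listPolylog (List.replicate (q - i) 1) t)) := fun i =>
    (isTame_ez (q - i)).const_mul _
  have h2 := mellin_congr h1 s
  rw [IsTame.mellin_const_mul, IsTame.mellin_add (IsTame.sum _ fun j _ => IsTame.sum _ fun c _ =>
    hG j c) (IsTame.sum _ fun i _ => hE i) hs, IsTame.mellin_sum _ (fun j _ => IsTame.sum _
    fun c _ => hG j c) hs, IsTame.mellin_sum _ (fun i _ => hE i) hs] at h2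
  have h3 : (-1 : ℂ) ^ q = (((-1 : ℝ) ^ q : ℝ) : ℂ) := by push_cast; rfl
  rw [itoZeta_eq, mul_left_comm, h3, h2, inv_mul_eq_iff_eq_mul₀ hΓ, relationRHS, mul_sub,
    sub_eq_add_neg, Finset.mul_sum, Finset.mul_sum, ← Finset.sum_neg_distrib]
  congr 1
  · refine Finset.sum_congr rfl fun j _ => ?_
    rw [IsTame.mellin_sum _ (fun c _ => hG j c) hs, Finset.mul_sum]
    refine Finset.sum_congr rfl fun c _ => ?_
    rw [IsTame.mellin_const_mul, mellin_dividedPower_mul, mellin_gmt j k c hs]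
    simp only [aCoeff_eq]
    push_cast
    -- The factor t^c/c! has turned Γ(s) into Γ(s+c)/c!, which is the binomial coefficient times
    -- Γ(s).
    linear_combination ((l + bCount j k).factorial * ∏ i, (aReal (j i) (k i) : ℂ)) *
      gmtZeta (zeroBlocks j k) (cIndex c s) *
      Gamma_add_natCast_div (s := s) (by linarith) (c (Fin.last q))
  · refine Finset.sum_congr rfl fun i _ => ?_
    rw [IsTame.mellin_const_mul, mellin_ez _ hs, gmtZeta_onesBlocks]
    push_cast
    ring

section

variable {n : ℕ} (l : ℕ) (k : Fin n → ℕ) (q : ℕ)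
  {Z Z' : (Fin n → ℕ) → (Fin (q + 1) → ℕ) → ℂ → ℂ} {E E' : ℕ → ℂ → ℂ} {s : ℂ}

theorem relationRHS_congr (hZ : ∀ j c, Z j c s = Z' j c s) (hE : ∀ d, E d s = E' d s) :
    relationRHS l k q Z E s = relationRHS l k q Z' E' s := by
  simp only [relationRHS, hZ, hE]

theorem meromorphicAt_relationRHS (hZ : ∀ j c, MeromorphicAt (Z j c) s)
    (hE : ∀ d, MeromorphicAt (E d) s) : MeromorphicAt (relationRHS l k q Z E) s := by
  refine MeromorphicAt.sub (MeromorphicAt.fun_sum fun j _ => MeromorphicAt.fun_sum fun c _ => ?_)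
    (MeromorphicAt.fun_sum fun i _ => ?_)
  · exact ((MeromorphicAt.const _ _).mul (analyticAt_ringChoose _ s).meromorphicAt).mul (hZ j c)
  · exact (MeromorphicAt.const _ _).mul (hE _)

theorem analyticAt_relationRHS
    (hZ : ∀ j ∈ Fintype.piFinset (fun i => Finset.Icc 0 (2 * k i - 2)),
      ∀ c ∈ Finset.Nat.antidiagonalTuple (q + 1) (l + bCount j k), AnalyticAt ℂ (Z j c) s)
    (hE : ∀ d < q, AnalyticAt ℂ (E d) s) : AnalyticAt ℂ (relationRHS l k q Z E) s := by
  refine AnalyticAt.sub (Finset.analyticAt_fun_sum _ fun j hj =>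
    Finset.analyticAt_fun_sum _ fun c hc => ?_) (Finset.analyticAt_fun_sum _ fun i hi => ?_)
  · exact (analyticAt_const.mul (analyticAt_ringChoose _ s)).mul (hZ j hj c hc)
  · have := Finset.mem_Icc.1 hi
    exact analyticAt_const.mul (hE _ (by omega))

end

theorem mainTheorem4 (n : ℕ) (hn : 1 ≤ n) (l : ℕ) (k : Fin n → ℕ) (hk : ∀ i, 2 ≤ k i) (q : ℕ) :
    -- the defining integral and all the series that occur converge absolutely
    ((∀ s : ℂ, 1 - ((l + n : ℕ) : ℝ) < s.re →
        MeasureTheory.IntegrableOn (itoIntegrand (onesAppend l k) q s) (Set.Ioi (0 : ℝ))) ∧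
      (∀ j ∈ Fintype.piFinset (fun i => Finset.Icc 0 (2 * k i - 2)),
        ∀ c ∈ Finset.Nat.antidiagonalTuple (q + 1) (l + bCount j k),
          ∀ s : ℂ, 1 < s.re → Summable (gmtTerm (zeroBlocks j k) (cIndex c s))) ∧
      (∀ i ∈ Finset.Icc 1 q,
        Summable (gmtTerm (onesBlocks l k) (fun _ : Fin 1 => (i : ℂ)))) ∧
      (∀ d < q, ∀ s : ℂ, 1 < s.re → Summable (ezTerm (onesSnoc d s)))) ∧
    -- the functions of `s` that occur have meromorphic continuations `Ξ`, `Z j c`, `E d` to `ℂ`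
    ∃ (Ξ : ℂ → ℂ) (Z : (Fin n → ℕ) → (Fin (q + 1) → ℕ) → ℂ → ℂ) (E : ℕ → ℂ → ℂ),
      IsMeromorphicContinuation (itoZeta (onesAppend l k) q) (1 - ((l + n : ℕ) : ℝ)) Ξ ∧
      (∀ j ∈ Fintype.piFinset (fun i => Finset.Icc 0 (2 * k i - 2)),
        ∀ c ∈ Finset.Nat.antidiagonalTuple (q + 1) (l + bCount j k),
          IsMeromorphicContinuation (fun s => gmtZeta (zeroBlocks j k) (cIndex c s)) 1 (Z j c)) ∧
      (∀ d < q, IsMeromorphicContinuation (fun s => ezZeta (onesSnoc d s)) 1 (E d)) ∧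
      -- the functional relation between meromorphic functions on `ℂ`
      (∀ s : ℂ, ∀ᶠ z in 𝓝[≠] s, (-1) ^ q * Ξ z = relationRHS l k q Z E z) ∧
      -- its values at every point where no term on the right-hand side has a pole
      (∀ s : ℂ,
        (∀ j ∈ Fintype.piFinset (fun i => Finset.Icc 0 (2 * k i - 2)),
          ∀ c ∈ Finset.Nat.antidiagonalTuple (q + 1) (l + bCount j k),
            AnalyticAt ℂ (Z j c) s) →
        (∀ d < q, AnalyticAt ℂ (E d) s) →
        AnalyticAt ℂ Ξ s ∧ (-1) ^ q * Ξ s = relationRHS l k q Z E s) := by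
  have hr : 0 < l + n := by omega
  have hh := one_le_onesAppend l hk
  refine ⟨⟨fun s hs => integrableOn_itoIntegrand hr hh q hs,
    fun j _ c _ s hs => summable_gmtTerm_zeroBlocks j k c hs,
    fun i hi => summable_gmtTerm_onesBlocks hn l hk (Finset.mem_Icc.1 hi).1,
    fun d _ s hs => summable_ezTerm d hs⟩, ?_⟩
  -- The continuations exist for all indices, not only those in the sum, so meromorphy of the
  -- right-hand side needs no range conditions.
  choose Z hZ using fun (j : Fin n → ℕ) (c : Fin (q + 1) → ℕ) =>
    exists_isMeromorphicContinuation_gmt j k c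
  choose E hE using exists_isMeromorphicContinuation_ez
  -- The continuation of the Ito function is built from the right-hand side. It agrees with the
  -- integral for Re s > 1, hence, by the identity theorem, near every point of the larger
  -- half-plane where the integral is analytic.
  set F : ℂ → ℂ := fun s => (-1) ^ q * relationRHS l k q Z E s with hF
  have hFm : MeromorphicOn F univ := fun s _ => (MeromorphicAt.const _ _).mul
    (meromorphicAt_relationRHS l k q (fun j c => (hZ j c).meromorphic.meromorphicOn s (mem_univ s))
      fun d => (hE d).meromorphic.meromorphicOn s (mem_univ s))
  have hsq : (-1 : ℂ) ^ q * (-1) ^ q = 1 := by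
    rw [← mul_pow, neg_one_mul, neg_neg, one_pow]
  have hFito : ∀ s : ℂ, 1 < s.re → F s = itoZeta (onesAppend l k) q s := fun s hs => by
    simp only [hF]
    rw [relationRHS_congr l k q (Z' := fun j c s => gmtZeta (zeroBlocks j k) (cIndex c s))
      (E' := fun d s => ezZeta (onesSnoc d s))
      (fun j c => (hZ j c).eq s hs)
      (fun d => (hE d).eq s hs),
      ← neg_one_pow_mul_itoZeta hn l hk q hs, ← mul_assoc, hsq, one_mul]
  have hΞ : IsMeromorphicContinuation (itoZeta (onesAppend l k) q) (1 - ((l + n : ℕ) : ℝ))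
      (toMeromorphicNFOn F univ) :=
    isMeromorphicContinuation_toMeromorphicNFOn hFm (fun s hs => analyticAt_itoZeta hr hh q hs)
      fun s hs => MeromorphicOn.eventuallyEq_of_halfPlane (hFm.mono_set (subset_univ _))
        (fun z hz => (analyticAt_itoZeta hr hh q hz).meromorphicAt) hFito hs
  have hev : ∀ s : ℂ, toMeromorphicNFOn F univ =ᶠ[𝓝[≠] s] F := fun s =>
    hFm.toMeromorphicNFOn_eq_self_on_nhdsNE (mem_univ s)
  refine ⟨toMeromorphicNFOn F univ, Z, E, hΞ, fun j _ c _ => hZ j c, fun d _ => hE d,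
    fun s => ?_, fun s hZs hEs => ?_⟩
  · filter_upwards [hev s] with z hz
    rw [hz, hF, ← mul_assoc, hsq, one_mul]
  · have hFa : AnalyticAt ℂ F s :=
      analyticAt_const.mul (analyticAt_relationRHS l k q hZs hEs)
    -- Two functions in normal form at s that agree on a punctured neighbourhood agree at s too; F
    -- is in normal form there because it is analytic.
    have heq : toMeromorphicNFOn F univ =ᶠ[𝓝 s] F :=
      (MeromorphicNFAt.eventuallyEq_nhdsNE_iff_eventuallyEq_nhds (hΞ.meromorphic (mem_univ s))
        hFa.meromorphicNFAt).1 (hev s)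
    refine ⟨hFa.congr heq.symm, ?_⟩
    rw [heq.eq_of_nhds, hF, ← mul_assoc, hsq, one_mul]
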